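/- Let $D\subset\mathbb R^d$, $d\ge 1$, be a nonempty bounded open set (for instance a bounded Lipschitz domain). Let $H_0^1(D)$ be the closure of $C_c^\infty(D)$ in $H^1(D)$ (for a bounded Lipschitz domain, the functions in $H^1(D)$ with zero trace), with norm $\|v\|_{H_0^1(D)}=\|\nabla v\|_{L^2(D)}$; let $H^{-1}(D)$ be its dual with the dual norm, and let $f\in H^{-1}(D)$. Let $c>0$, $0<\tau\le\beta$, and let $\boldsymbol\alpha=(\alpha_j)_{j\ge1}\in\ell^1(\mathbb N)$ be nonnegative, with $\|\boldsymbol\alpha\|_\infty<\beta^{-1}$ if $\tau=\beta$. Put $$U_{\boldsymbol\alpha,\tau}=\Big\{\boldsymbol y\in\mathbb R^{\mathbb N}:\sum_{j\ge1}\alpha_j|y_j|^\tau<\infty\Big\},\qquad a_{\min}(\boldsymbol y)=c\,\exp\Big(-\sum_{j\ge1}\alpha_j|y_j|^\tau\Big).$$ For a finitely supported multi-index $\boldsymbol\nu\in\mathbb N_0^{\mathbb N}$ write $|\boldsymbol\nu|=\sum_j\nu_j$, $\boldsymbol b^{\boldsymbol\nu}=\prod_j b_j^{\nu_j}$ (with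 $0^0=1$) and $\partial^{\boldsymbol\nu}=\prod_j\partial^{\nu_j}/\partial y_j^{\nu_j}$. Let $a:D\times U_{\boldsymbol\alpha,\tau}\to\mathbb R$ be such that $a(\cdot,\boldsymbol y)$ is measurable for every $\boldsymbol y\in U_{\boldsymbol\alpha,\tau}$ and, for every $\boldsymbol x\in D$, the function $\boldsymbol y\mapsto a(\boldsymbol x,\boldsymbol y)$ has mixed partial derivatives of all orders on $U_{\boldsymbol\alpha,\tau}$, independent of the order of differentiation. Assume that there are $\sigma\ge1$, $C>0$ and a sequence $\boldsymbol b=(b_j)_{j\ge1}$ of nonnegative numbers such that * (A1) $\displaystyle\Big\|\frac{\partial^{\boldsymbol\nu}a(\cdot,\boldsymbol y)}{a(\cdot,\boldsymbol y)}\Big\|_{L^\infty(D)}\le C(|\boldsymbol\nu|!)^\sigma\boldsymbol b^{\boldsymbol\nu}$ for all $\boldsymbol y\in U_{\boldsymbol\alpha,\tau}$ and all finitely supported multi-indices $\boldsymbol\nu$; * (A5) $a(\boldsymbol x,\boldsymbol y)\ge a_{\min}(\boldsymbol y)$ for all $\boldsymbol x\in D$ and $\boldsymbol y\in U_{\boldsymbol\alpha,\tau}$.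 Call $w\in H_0^1(D)$ a weak solution at $\boldsymbol y$ if, for all $v\in H_0^1(D)$, the integral on the left exists and $$\int_D a(\boldsymbol x,\boldsymbol y)\,\nabla w(\boldsymbol x)\cdot\nabla v(\boldsymbol x)\,\mathrm d\boldsymbol x=\langle f,v\rangle_{H^{-1}(D),H_0^1(D)}.$$ Then: 1. For every $\boldsymbol y\in U_{\boldsymbol\alpha,\tau}$ with $a(\cdot,\boldsymbol y)\in L^\infty(D)$ there is exactly one weak solution at $\boldsymbol y$. 2. If $u(\cdot,\boldsymbol y)\in H_0^1(D)$ is a weak solution at $\boldsymbol y$ for every $\boldsymbol y\in U_{\boldsymbol\alpha,\tau}$, then $\boldsymbol y\mapsto u(\cdot,\boldsymbol y)\in H_0^1(D)$ has mixed partial derivatives of all orders on $U_{\boldsymbol\alpha,\tau}$ (limits of difference quotients in the norm of $H_0^1(D)$), independent of the order of differentiation, and is Gevrey regular with the same parameter $\sigma$: for all finitely supported $\boldsymbol\nu\ne\boldsymbol 0$ and all $\boldsymbol y\in U_{\boldsymbol\alpha,\tau}$, $$\|\partial^{\boldsymbol\nu}u(\cdot,\boldsymbol y)\|_{H_0^1(D)}\le\frac{\|f\|_{H^{-1}(D)}}{a_{\min}(\boldsymbol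 y)}\,C(C+1)^{|\boldsymbol\nu|-1}(|\boldsymbol\nu|!)^\sigma\,\boldsymbol b^{\boldsymbol\nu},$$ where $C$ is the constant in (A1). -/

import Mathlib

open MeasureTheory Set Filter
open scoped ContDiff

noncomputable section

/-! ### The spatial domain and the space `H¹₀(D)` -/

/-- A nonempty bounded open set `D ⊆ ℝᵈ`, `d ≥ 1`. -/
structure BoundedOpen (d : ℕ) where
  carrier : Set (EuclideanSpace ℝ (Fin d))
  dim_pos : 0 < d
  isOpen : IsOpen carrier
  nonempty : carrier.Nonempty
  isBounded : Bornology.IsBounded carrier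

namespace BoundedOpen

variable {d : ℕ} (D : BoundedOpen d)

/-- Lebesgue measure on `D`. -/
abbrev vol : Measure (EuclideanSpace ℝ (Fin d)) := volume.restrict D.carrier

/-- `φ ∈ C_c^∞(D)`, as a function on all of `ℝᵈ`. -/
structure IsTestFunction (φ : EuclideanSpace ℝ (Fin d) → ℝ) : Prop where
  smooth : ContDiff ℝ ∞ φ
  compact : HasCompactSupport φ
  tsupport_subset : tsupport φ ⊆ D.carrier

/-- The product `L²(D) × L²(D; ℝᵈ)`, in which a function `v` with weak gradient `∇v` is
recorded as the pair `(v, ∇v)`. The topology is that of the `H¹(D)` norm. -/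
abbrev PairSpace : Type :=
  Lp ℝ 2 D.vol × Lp (EuclideanSpace ℝ (Fin d)) 2 D.vol

/-- The pairs `(φ, ∇φ)` with `φ ∈ C_c^∞(D)`. -/
def testPairs : Submodule ℝ D.PairSpace where
  carrier := {p | ∃ φ, D.IsTestFunction φ ∧ p.1 =ᵐ[D.vol] φ ∧ p.2 =ᵐ[D.vol] gradient φ}
  zero_mem' := by
    refine ⟨0, ⟨contDiff_const, HasCompactSupport.zero, by simp⟩, Lp.coeFn_zero _ _ _, ?_⟩
    have h : gradient (0 : EuclideanSpace ℝ (Fin d) → ℝ) = 0 := by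
      funext x
      exact gradient_const x 0
    rw [h]
    exact Lp.coeFn_zero _ _ _
  add_mem' := by
    rintro p q ⟨φ, hφ, h1, h2⟩ ⟨ψ, hψ, h3, h4⟩
    refine ⟨φ + ψ, ⟨hφ.smooth.add hψ.smooth, hφ.compact.add hψ.compact, ?_⟩, ?_, ?_⟩
    · exact (tsupport_add φ ψ).trans (union_subset hφ.tsupport_subset hψ.tsupport_subset)
    · filter_upwards [Lp.coeFn_add p.1 q.1, h1, h3] with x hx hx1 hx3
      change (p.1 + q.1 : Lp ℝ 2 D.vol) x = φ x + ψ x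
      rw [hx, Pi.add_apply, hx1, hx3]
    · filter_upwards [Lp.coeFn_add p.2 q.2, h2, h4] with x hx hx2 hx4
      have e1 : DifferentiableAt ℝ φ x := hφ.smooth.differentiable (by simp) x
      have e2 : DifferentiableAt ℝ ψ x := hψ.smooth.differentiable (by simp) x
      simp only [Prod.snd_add, hx, Pi.add_apply, hx2, hx4, gradient, fderiv_add e1 e2, map_add]
  smul_mem' := by
    rintro c p ⟨φ, hφ, h1, h2⟩
    refine ⟨c • φ, ⟨contDiff_const.smul hφ.smooth, ?_, ?_⟩, ?_, ?_⟩
    · exact hφ.compact.smul_left (f := fun _ => c)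
    · exact (tsupport_smul_subset_right (fun _ => c) φ).trans hφ.tsupport_subset
    · filter_upwards [Lp.coeFn_smul c p.1, h1] with x hx hx1
      simp [hx, hx1]
    · filter_upwards [Lp.coeFn_smul c p.2, h2] with x hx hx2
      have e1 : DifferentiableAt ℝ φ x := hφ.smooth.differentiable (by simp) x
      simp only [Prod.smul_snd, hx, Pi.smul_apply, hx2, gradient, fderiv_const_smul e1, map_smul]

/-- Integration by parts for `φ²` against a coordinate function, followed by Young's inequality. -/
theorem test_poincare {R : ℝ} (hR : ∀ x ∈ D.carrier, ‖x‖ ≤ R)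
    {φ : EuclideanSpace ℝ (Fin d) → ℝ} (hφ : D.IsTestFunction φ) :
    ∫ x, φ x ^ 2 ∂D.vol ≤ 4 * R ^ 2 * ∫ x, ‖gradient φ x‖ ^ 2 ∂D.vol := by
  obtain ⟨i⟩ : Nonempty (Fin d) := ⟨⟨0, D.dim_pos⟩⟩
  obtain ⟨e, hei, hen⟩ : ∃ e : EuclideanSpace ℝ (Fin d), e i = 1 ∧ ‖e‖ = 1 :=
    ⟨EuclideanSpace.single i (1 : ℝ), by simp, by simp⟩
  have hdiff : Differentiable ℝ φ := hφ.smooth.differentiable (by simp)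
  have hcont : Continuous φ := hφ.smooth.continuous
  have hfd : Continuous (fderiv ℝ φ) := hφ.smooth.continuous_fderiv (by simp)
  have hfdc : HasCompactSupport (fderiv ℝ φ) := hφ.compact.fderiv (𝕜 := ℝ)
  have hgr : Continuous (gradient φ) :=
    (InnerProductSpace.toDual ℝ (EuclideanSpace ℝ (Fin d))).symm.continuous.comp hfd
  have hgrc : HasCompactSupport (gradient φ) :=
    hfdc.comp_left (g := (InnerProductSpace.toDual ℝ (EuclideanSpace ℝ (Fin d))).symm) (map_zero _)
  have hl : ∀ x : EuclideanSpace ℝ (Fin d), HasFDerivAt (fun x : EuclideanSpace ℝ (Fin d) => x i)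
      (EuclideanSpace.proj i : EuclideanSpace ℝ (Fin d) →L[ℝ] ℝ) x := fun x =>
    (EuclideanSpace.proj i : EuclideanSpace ℝ (Fin d) →L[ℝ] ℝ).hasFDerivAt
  have hl1 : ∀ x : EuclideanSpace ℝ (Fin d),
      fderiv ℝ (fun x : EuclideanSpace ℝ (Fin d) => x i) x e = 1 := by
    intro x
    rw [(hl x).fderiv]
    simpa using hei
  have hsq : ∀ x, fderiv ℝ (fun x => φ x ^ 2) x e = 2 * φ x * fderiv ℝ φ x e := by
    intro x
    have h := ((hdiff x).hasFDerivAt.pow 2).fderiv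
    rw [h]
    simp
  have hi : Continuous fun x : EuclideanSpace ℝ (Fin d) => x i :=
    (EuclideanSpace.proj i : EuclideanSpace ℝ (Fin d) →L[ℝ] ℝ).continuous
  have hfe : Continuous fun x => fderiv ℝ φ x e := hfd.clm_apply continuous_const
  have csq : HasCompactSupport fun x => φ x ^ 2 := by
    simp only [sq]
    exact hφ.compact.mul_left (f := φ)
  have isq : Integrable (fun x => φ x ^ 2) :=
    (hcont.pow 2).integrable_of_hasCompactSupport csq
  have cgr : HasCompactSupport fun x => ‖gradient φ x‖ ^ 2 := by
    simp only [sq]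
    exact hgrc.norm.mul_left (f := fun x => ‖gradient φ x‖)
  have igr : Integrable (fun x => ‖gradient φ x‖ ^ 2) :=
    (hgr.norm.pow 2).integrable_of_hasCompactSupport cgr
  have key : ∫ x, φ x ^ 2 = - ∫ x, x i * (2 * φ x * fderiv ℝ φ x e) := by
    have h := integral_mul_fderiv_eq_neg_fderiv_mul_of_integrable
      (μ := (volume : Measure (EuclideanSpace ℝ (Fin d)))) (𝕜 := ℝ) (v := e)
      (f := fun x : EuclideanSpace ℝ (Fin d) => x i) (g := fun x => φ x ^ 2) ?_ ?_ ?_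
      (fun x _ => (hl x).differentiableAt) (fun x _ => (hdiff x).pow 2)
    · simp only [hl1, hsq, one_mul] at h
      linarith
    · simpa only [hl1, one_mul] using isq
    · simp only [hsq]
      exact (hi.mul ((continuous_const.mul hcont).mul hfe)).integrable_of_hasCompactSupport
        ((hφ.compact.mul_left (f := fun _ => (2 : ℝ))).mul_right.mul_left)
    · exact (hi.mul (hcont.pow 2)).integrable_of_hasCompactSupport csq.mul_left
  have hz : ∀ x, x ∉ D.carrier → φ x = 0 := fun x hx =>
    image_eq_zero_of_notMem_tsupport fun h => hx (hφ.tsupport_subset h)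
  have hgz : ∀ x, x ∉ D.carrier → gradient φ x = 0 := by
    intro x hx
    have h : fderiv ℝ φ x = 0 := image_eq_zero_of_notMem_tsupport
      fun h => hx (hφ.tsupport_subset (tsupport_fderiv_subset ℝ h))
    simp [gradient, h]
  have r1 : ∫ x, φ x ^ 2 ∂D.vol = ∫ x, φ x ^ 2 :=
    setIntegral_eq_integral_of_forall_compl_eq_zero fun x hx => by simp [hz x hx]
  have r2 : ∫ x, ‖gradient φ x‖ ^ 2 ∂D.vol = ∫ x, ‖gradient φ x‖ ^ 2 :=
    setIntegral_eq_integral_of_forall_compl_eq_zero fun x hx => by simp [hgz x hx]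
  rw [r1, r2]
  have hpt : ∀ x, -(x i * (2 * φ x * fderiv ℝ φ x e)) ≤
      (1 / 2) * φ x ^ 2 + 2 * R ^ 2 * ‖gradient φ x‖ ^ 2 := by
    intro x
    by_cases hx : x ∈ D.carrier
    · have h1 : |x i| ≤ R := (Real.norm_eq_abs (x i) ▸ PiLp.norm_apply_le x i).trans (hR x hx)
      have h2 : |fderiv ℝ φ x e| ≤ ‖gradient φ x‖ := by
        have h3 : inner ℝ (gradient φ x) e = fderiv ℝ φ x e := by
          simp [gradient]
        rw [← h3]
        refine (abs_real_inner_le_norm _ _).trans ?_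
        simp [hen]
      have h4 : (x i * fderiv ℝ φ x e) ^ 2 ≤ R ^ 2 * ‖gradient φ x‖ ^ 2 := by
        rw [mul_pow]
        exact mul_le_mul (sq_le_sq' (by linarith [(abs_le.1 h1).1]) (abs_le.1 h1).2)
          (sq_le_sq' (by linarith [(abs_le.1 h2).1]) (abs_le.1 h2).2) (sq_nonneg _) (sq_nonneg _)
      nlinarith [sq_nonneg (φ x + 2 * (x i * fderiv ℝ φ x e))]
    · rw [hz x hx]
      have : 0 ≤ 2 * R ^ 2 * ‖gradient φ x‖ ^ 2 := by positivity
      simpa using this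
  have hle : ∫ x, φ x ^ 2 ≤ ∫ x, ((1 / 2) * φ x ^ 2 + 2 * R ^ 2 * ‖gradient φ x‖ ^ 2) := by
    rw [key, ← integral_neg]
    refine integral_mono ?_ ((isq.const_mul _).add (igr.const_mul _)) hpt
    exact ((hi.mul ((continuous_const.mul hcont).mul hfe)).integrable_of_hasCompactSupport
        ((hφ.compact.mul_left (f := fun _ => (2 : ℝ))).mul_right.mul_left)).neg
  rw [integral_add (isq.const_mul _) (igr.const_mul _), integral_const_mul,
    integral_const_mul] at hle
  linarith

theorem norm_fst_le {R : ℝ} (hR : ∀ x ∈ D.carrier, ‖x‖ ≤ R) (hR0 : 0 ≤ R)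
    {p : D.PairSpace} (hp : p ∈ D.testPairs.topologicalClosure) : ‖p.1‖ ≤ 2 * R * ‖p.2‖ := by
  have hcl : IsClosed {p : D.PairSpace | ‖p.1‖ ≤ 2 * R * ‖p.2‖} :=
    isClosed_le (by fun_prop) (by fun_prop)
  refine (closure_minimal ?_ hcl) hp
  rintro q ⟨φ, hφ, h1, h2⟩
  have e1 : ‖q.1‖ ^ 2 = ∫ x, φ x ^ 2 ∂D.vol := by
    rw [← real_inner_self_eq_norm_sq, L2.inner_def]
    refine integral_congr_ae ?_
    filter_upwards [h1] with x hx
    rw [hx, real_inner_self_eq_norm_sq, Real.norm_eq_abs, sq_abs]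
  have e2 : ‖q.2‖ ^ 2 = ∫ x, ‖gradient φ x‖ ^ 2 ∂D.vol := by
    rw [← real_inner_self_eq_norm_sq, L2.inner_def]
    refine integral_congr_ae ?_
    filter_upwards [h2] with x hx
    rw [hx, real_inner_self_eq_norm_sq]
  have := D.test_poincare hR hφ
  rw [← e1, ← e2] at this
  refine (sq_le_sq₀ (norm_nonneg _) (by positivity)).1 ?_
  rw [mul_pow, mul_pow]
  linarith

/-- The Sobolev space `H¹₀(D)`: the closure of `C_c^∞(D)` in `H¹(D)`, where a function is recorded
together with its weak gradient. -/
def H10 : Type := D.testPairs.topologicalClosure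

namespace H10

instance : AddCommGroup D.H10 := inferInstanceAs (AddCommGroup D.testPairs.topologicalClosure)

instance : Module ℝ D.H10 := inferInstanceAs (Module ℝ D.testPairs.topologicalClosure)

variable {D}

/-- The underlying function of an element of `H¹₀(D)`. -/
def toFun : D.H10 →ₗ[ℝ] Lp ℝ 2 D.vol :=
  (LinearMap.fst ℝ _ _) ∘ₗ D.testPairs.topologicalClosure.subtype

/-- The weak gradient of an element of `H¹₀(D)`. -/
def grad : D.H10 →ₗ[ℝ] Lp (EuclideanSpace ℝ (Fin d)) 2 D.vol :=
  (LinearMap.snd ℝ _ _) ∘ₗ D.testPairs.topologicalClosure.subtype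

theorem grad_injective : Function.Injective (grad : D.H10 →ₗ[ℝ] _) := by
  rw [injective_iff_map_eq_zero]
  intro v hv
  obtain ⟨R, hR⟩ := D.isBounded.exists_norm_le
  have h := D.norm_fst_le (R := max R 0) (fun x hx => (hR x hx).trans (le_max_left _ _))
    (le_max_right _ _) v.2
  have h2 : v.1.2 = 0 := hv
  rw [h2, norm_zero, mul_zero] at h
  exact Subtype.ext (Prod.ext (norm_le_zero_iff.1 h) h2)

/-- The norm `‖v‖ = ‖∇v‖_{L²(D)}` on `H¹₀(D)`. -/
instance : NormedAddCommGroup D.H10 := NormedAddCommGroup.induced _ _ grad grad_injective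

/-- The inner product `⟨v, w⟩ = ⟨∇v, ∇w⟩_{L²(D)}` on `H¹₀(D)`. -/
instance : InnerProductSpace ℝ D.H10 where
  norm_smul_le c v := by
    change ‖grad (c • v)‖ ≤ ‖c‖ * ‖grad v‖
    rw [map_smul, norm_smul]
  inner v w := inner ℝ (grad v) (grad w)
  norm_sq_eq_re_inner v := (real_inner_self_eq_norm_sq (grad v)).symm
  conj_inner_symm v w := real_inner_comm (grad v) (grad w)
  add_left u v w := by
    change inner ℝ (grad (u + v)) (grad w) = _
    rw [map_add, inner_add_left]
  smul_left u v c := by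
    change inner ℝ (grad (c • u)) (grad v) = _
    rw [map_smul, real_inner_smul_left]
    rfl

end H10

/-- The dual space `H⁻¹(D)` of `H¹₀(D)`, with the dual (operator) norm; `f v` is the duality
pairing. -/
abbrev Hneg1 : Type := StrongDual ℝ D.H10

/-- `w ∈ H¹₀(D)` is a weak solution of `-∇ · (κ ∇w) = f`: for all `v ∈ H¹₀(D)` the integral
`∫_D κ ∇w · ∇v` exists and equals `⟨f, v⟩`. -/
def IsWeakSolution (κ : EuclideanSpace ℝ (Fin d) → ℝ) (f : D.Hneg1) (w : D.H10) : Prop :=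
  ∀ v : D.H10,
    Integrable (fun x => κ x * inner ℝ (H10.grad w x) (H10.grad v x)) D.vol ∧
      ∫ x, κ x * inner ℝ (H10.grad w x) (H10.grad v x) ∂D.vol = f v

end BoundedOpen

/-! ### Parameters, multi-indices and mixed partial derivatives -/

/-- The parameter set `U_{α,τ} = {y ∈ ℝ^ℕ : ∑ⱼ αⱼ |yⱼ|^τ < ∞}`. -/
def paramSet (α : ℕ → ℝ) (τ : ℝ) : Set (ℕ → ℝ) :=
  {y | Summable fun j => α j * |y j| ^ τ}

/-- `bᵛ = ∏ⱼ bⱼ^{νⱼ}` for a finitely supported multi-index `ν`. -/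
def multiPow (b : ℕ → ℝ) (ν : ℕ →₀ ℕ) : ℝ := ν.prod fun j k => b j ^ k

section Derivatives

variable {E : Type*} [NormedAddCommGroup E] [NormedSpace ℝ E]

/-- The partial derivative `∂g/∂yⱼ`. -/
def partialDeriv (j : ℕ) (g : (ℕ → ℝ) → E) : (ℕ → ℝ) → E :=
  fun y => deriv (fun t : ℝ => g (Function.update y j t)) (y j)

/-- The mixed partial derivative `∂ᵛg = ∏ⱼ ∂^{νⱼ}/∂yⱼ^{νⱼ} g`, the derivatives being taken in the
order of decreasing `j`. -/
def mixedPartial (ν : ℕ →₀ ℕ) (g : (ℕ → ℝ) → E) : (ℕ → ℝ) → E :=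
  (ν.support.sort (· ≤ ·)).foldr (fun j h => (partialDeriv j)^[ν j] h) g

/-- `g` has mixed partial derivatives of all orders at all points of `U`, and they do not depend on
the order of differentiation: each `∂ᵛg` is differentiable in each `yⱼ`, with derivative
`∂^{ν+eⱼ}g`. -/
def HasAllMixedPartials (U : Set (ℕ → ℝ)) (g : (ℕ → ℝ) → E) : Prop :=
  ∀ ν : ℕ →₀ ℕ, ∀ y ∈ U, ∀ j : ℕ,
    HasDerivAt (fun t : ℝ => mixedPartial ν g (Function.update y j t))
      (mixedPartial (ν + Finsupp.single j 1) g y) (y j)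

end Derivatives

/-! ### The assumptions on the coefficient -/

/-- `a_min(y) = c exp(-∑ⱼ αⱼ |yⱼ|^τ)`. -/
def aMin (c : ℝ) (α : ℕ → ℝ) (τ : ℝ) (y : ℕ → ℝ) : ℝ :=
  c * Real.exp (-∑' j, α j * |y j| ^ τ)

/-- The coefficient `a : D × U → ℝ` has partial derivatives of all orders with respect to `y ∈ U`,
and `‖∂ᵛa(·,y) / a(·,y)‖_{L^∞(D)} ≤ C (|ν|!)^σ bᵛ` for all `y ∈ U` and all multi-indices `ν`. -/
structure IsGevreyCoefficient {d : ℕ} (D : BoundedOpen d) (U : Set (ℕ → ℝ))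
    (a : EuclideanSpace ℝ (Fin d) → (ℕ → ℝ) → ℝ) (σ C : ℝ) (b : ℕ → ℝ) : Prop where
  one_le_sigma : 1 ≤ σ
  C_pos : 0 < C
  b_nonneg : ∀ j, 0 ≤ b j
  measurable : ∀ y ∈ U, AEStronglyMeasurable (fun x => a x y) D.vol
  smooth : ∀ x ∈ D.carrier, HasAllMixedPartials U (a x)
  bound : ∀ y ∈ U, ∀ ν : ℕ →₀ ℕ,
    eLpNorm (fun x => mixedPartial ν (a x) y / a x y) ⊤ D.vol ≤
      ENNReal.ofReal (C * (ν.degree.factorial : ℝ) ^ σ * multiPow b ν)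

/-- `a(x,y) ≥ a_min(y)` for all `x ∈ D` and `y ∈ U_{α,τ}`, where `c > 0`, `0 < τ ≤ β`, and
`α ∈ ℓ¹(ℕ)` is nonnegative, with `‖α‖_∞ < 1/β` if `τ = β`. -/
structure IsLowerBounded {d : ℕ} (D : BoundedOpen d)
    (a : EuclideanSpace ℝ (Fin d) → (ℕ → ℝ) → ℝ) (c : ℝ) (α : ℕ → ℝ) (τ β : ℝ) : Prop where
  c_pos : 0 < c
  tau_pos : 0 < τ
  tau_le : τ ≤ β
  alpha_nonneg : ∀ j, 0 ≤ α j
  alpha_summable : Summable α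
  alpha_lt : τ = β → (⨆ j, |α j|) < β⁻¹
  lower : ∀ x ∈ D.carrier, ∀ y ∈ paramSet α τ, aMin c α τ y ≤ a x y

end

open Finset (HasAntidiagonal)

noncomputable section


/-! ### Sums over pairs of multi-indices with a given sum -/

section Antidiagonal

open Finset

/-! Fix a base point `y₀` and measure everything relative to `a(·,y₀)`. The coefficient need not be
bounded, but (A1) controls its derivatives relative to itself. By Gronwall along a coordinate line,
`a(·,y)` and `a(·,y₀)` are then comparable whenever `y` is reached from `y₀` by changing coordinates
one at a time, and `∂ᵛa(·,y)/a(·,y₀)` lies in `L^∞(D)`, where it is differentiable in each `yⱼ`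
(`hasDerivAt_relativePartial`).

Substituting `g = a(·,y₀)^{1/2} ∇v` identifies the functions of finite energy at `y₀` with a closed
subspace of `L²(D; ℝᵈ)`. There the weak equation at `y` reads `T(y) g = F`, where `T(y)` is the
compression of multiplication by `a(·,y)/a(·,y₀)` and `F` is the Riesz representative of `f`. A weak
solution has finite energy because it may be tested with itself (`exists_compression_eq_riesz`). By
construction `T(y₀) = 1`, and (A1) bounds `∂ᵛT(y₀)` with the same constant `C`.

Read `∂ᵛT/ν!` as the coefficients of a formal power series. The coefficients of its inverse, times
`ν!`, are the mixed partials of `T⁻¹` (`hasDerivAt_inverse_coeff`, `mixedPartial_eq_of_hasDerivAt`);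
applied to `F` and mapped back to `H¹₀(D)` they are those of `u`. The bound follows from the
recursion `Q_ν = -∑_{μ≠0} B_μ Q_{ν-μ}` (`norm_inverse_coeff_le`): the multinomial Vandermonde
identity reduces it to orders, `σ ≥ 1` absorbs the binomial coefficients, and `C (θ₀ + ⋯ + θₙ₋₁) =
θₙ` closes the induction. The passage from `f` to `F` and the one back to `H¹₀(D)` each cost at most
`a_min(y₀)^{-1/2}`.

If `a(·,y₀)` is bounded, every test function has finite energy, so `F` itself yields the weak
solution at `y₀`. Uniqueness is coercivity. -/

theorem sum_antidiagonal_prodComm {E M : Type*} [AddCommMonoid E] [AddCommMonoid M]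
    [HasAntidiagonal M]
    (n : M) (f : M × M → E) :
    ∑ p ∈ HasAntidiagonal.antidiagonal n, f p = ∑ p ∈ HasAntidiagonal.antidiagonal n, f p.swap :=
  sum_equiv (Equiv.prodComm M M) (by simp [add_comm]) (by simp)

variable {E : Type*} [AddCommGroup E] [Module ℝ E]

/-- The weight `p.1 j` kills the pairs whose first entry does not involve `j`; the others are
exactly the shifts by `eⱼ` of pairs with sum `ν`. -/
theorem sum_antidiagonal_add_single_fst (F : (ℕ →₀ ℕ) → (ℕ →₀ ℕ) → E) (ν : ℕ →₀ ℕ) (j : ℕ) :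
    ∑ p ∈ HasAntidiagonal.antidiagonal (ν + Finsupp.single j 1),
        ((p : (ℕ →₀ ℕ) × (ℕ →₀ ℕ)).1 j : ℝ) • F p.1 p.2 =
      ∑ p ∈ HasAntidiagonal.antidiagonal ν,
        ((p.1 j : ℝ) + 1) • F (p.1 + Finsupp.single j 1) p.2 := by
  symm
  refine sum_of_injOn (fun p => (p.1 + Finsupp.single j 1, p.2)) ?_ ?_ ?_ ?_
  · rintro ⟨p, q⟩ - ⟨p', q'⟩ - h
    simpa using h
  · rintro ⟨p, q⟩ h
    simp only [mem_coe, HasAntidiagonal.mem_antidiagonal] at h ⊢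
    rw [← h, add_right_comm]
  · rintro ⟨p, q⟩ h h'
    rw [HasAntidiagonal.mem_antidiagonal] at h
    have hp : p j = 0 := by
      dsimp only at h
      by_contra hp
      refine h' ⟨(p - Finsupp.single j 1, q), ?_, ?_⟩
      · simp only [mem_coe, HasAntidiagonal.mem_antidiagonal]
        ext i
        have := DFunLike.congr_fun h i
        simp only [Finsupp.add_apply, Finsupp.tsub_apply] at this ⊢
        by_cases hi : i = j
        · subst hi; simp at this ⊢; omega
        · simp [Ne.symm hi] at this ⊢; omega
      · simp only [Prod.mk.injEq, and_true]
        ext i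
        simp only [Finsupp.add_apply, Finsupp.tsub_apply]
        by_cases hi : i = j
        · subst hi; simp; omega
        · simp [Ne.symm hi]
    simp [hp]
  · rintro ⟨p, q⟩ -
    simp

theorem sum_antidiagonal_add_single_snd (F : (ℕ →₀ ℕ) → (ℕ →₀ ℕ) → E) (ν : ℕ →₀ ℕ) (j : ℕ) :
    ∑ p ∈ HasAntidiagonal.antidiagonal (ν + Finsupp.single j 1),
        ((p : (ℕ →₀ ℕ) × (ℕ →₀ ℕ)).2 j : ℝ) • F p.1 p.2 =
      ∑ p ∈ HasAntidiagonal.antidiagonal ν,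
        ((p.2 j : ℝ) + 1) • F p.1 (p.2 + Finsupp.single j 1) := by
  rw [sum_antidiagonal_prodComm, sum_antidiagonal_prodComm ν]
  exact sum_antidiagonal_add_single_fst (fun p q => F q p) ν j

/-- The Leibniz rule for sums over multi-indices. -/
theorem sum_antidiagonal_add_single (F : (ℕ →₀ ℕ) → (ℕ →₀ ℕ) → E) (ν : ℕ →₀ ℕ) (j : ℕ) :
    ((ν j : ℝ) + 1) • ∑ p ∈ HasAntidiagonal.antidiagonal (ν + Finsupp.single j 1), F p.1 p.2 =
      ∑ p ∈ HasAntidiagonal.antidiagonal ν, (((p.1 j : ℝ) + 1) • F (p.1 + Finsupp.single j 1) p.2 +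
        ((p.2 j : ℝ) + 1) • F p.1 (p.2 + Finsupp.single j 1)) := by
  rw [sum_add_distrib, ← sum_antidiagonal_add_single_fst, ← sum_antidiagonal_add_single_snd,
    ← sum_add_distrib, smul_sum]
  refine sum_congr rfl fun p hp => ?_
  rw [← add_smul]
  congr 1
  have := DFunLike.congr_fun (HasAntidiagonal.mem_antidiagonal.1 hp) j
  simp only [Finsupp.add_apply, Finsupp.single_eq_same] at this
  exact_mod_cast this.symm

end Antidiagonal

/-! ### Factorials of multi-indices -/

/-- `ν! = ∏ⱼ νⱼ!`. -/
def multiFactorial (ν : ℕ →₀ ℕ) : ℝ := ν.prod fun _ k => (k.factorial : ℝ)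

theorem multiFactorial_zero : multiFactorial 0 = 1 := by simp [multiFactorial]

theorem multiFactorial_pos (ν : ℕ →₀ ℕ) : 0 < multiFactorial ν :=
  Finset.prod_pos fun _ _ => by positivity

theorem multiFactorial_add_single (ν : ℕ →₀ ℕ) (j : ℕ) :
    multiFactorial (ν + Finsupp.single j 1) = ((ν j : ℝ) + 1) * multiFactorial ν := by
  classical
  have h1 : ∀ μ : ℕ →₀ ℕ, μ.support ⊆ insert j ν.support →
      multiFactorial μ = ∏ i ∈ insert j ν.support, ((μ i).factorial : ℝ) := fun μ h =>
    Finsupp.prod_of_support_subset _ h _ (by simp)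
  rw [h1 (ν + Finsupp.single j 1), h1 ν (Finset.subset_insert _ _),
    ← Finset.mul_prod_erase _ _ (Finset.mem_insert_self j _),
    ← Finset.mul_prod_erase _ (fun i => ((ν i).factorial : ℝ)) (Finset.mem_insert_self j _),
    ← mul_assoc]
  · congr 1
    · simp [Nat.factorial_succ]
    · refine Finset.prod_congr rfl fun i hi => ?_
      have : j ≠ i := (Finset.ne_of_mem_erase hi).symm
      simp [this]
  · refine Finsupp.support_add.trans (Finset.union_subset (Finset.subset_insert _ _) ?_)
    exact Finsupp.support_single_subset.trans (by simp)

theorem multiPow_zero (b : ℕ → ℝ) : multiPow b 0 = 1 := by simp [multiPow]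

theorem multiPow_add (b : ℕ → ℝ) (μ κ : ℕ →₀ ℕ) :
    multiPow b (μ + κ) = multiPow b μ * multiPow b κ :=
  Finsupp.prod_add_index' (by simp) fun _ _ _ => pow_add _ _ _

theorem multiPow_nonneg {b : ℕ → ℝ} (hb : ∀ j, 0 ≤ b j) (ν : ℕ →₀ ℕ) : 0 ≤ multiPow b ν :=
  Finset.prod_nonneg fun _ _ => pow_nonneg (hb _) _

theorem multiIndex_induction {P : (ℕ →₀ ℕ) → Prop} (h0 : P 0)
    (hs : ∀ ν j, P ν → P (ν + Finsupp.single j 1)) (ν : ℕ →₀ ℕ) : P ν := by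
  induction ν using Finsupp.induction with
  | zero => exact h0
  | single_add j n ν _ _ ih =>
    clear * - ih hs
    induction n with
    | zero => simpa using ih
    | succ n ihn =>
      have := hs _ j ihn
      rwa [add_right_comm, ← Finsupp.single_add] at this

/-- Summing over all pairs with fixed orders, by the multinomial Vandermonde identity. -/
theorem sum_antidiagonal_multiFactorial (ν : ℕ →₀ ℕ) (g h : ℕ → ℝ) :
    ∑ p ∈ HasAntidiagonal.antidiagonal ν,
        g p.1.degree / multiFactorial p.1 * (h p.2.degree / multiFactorial p.2) =
      (∑ p ∈ HasAntidiagonal.antidiagonal ν.degree, (ν.degree.choose p.1 : ℝ) * (g p.1 * h p.2)) /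
        multiFactorial ν := by
  induction ν using multiIndex_induction generalizing g h with
  | h0 => simp [multiFactorial_zero]
  | hs ν j ih =>
    have hj : (0 : ℝ) < (ν j : ℝ) + 1 := by positivity
    have hd : (ν + Finsupp.single j 1).degree = ν.degree + 1 := by simp
    have key := sum_antidiagonal_add_single
      (fun μ κ => g μ.degree / multiFactorial μ * (h κ.degree / multiFactorial κ)) ν j
    -- Raising `ν` by `eⱼ` shifts either `g` or `h` by one order. This matches Pascal's rule for
    -- `ν.degree + 1`, and is why `g` and `h` vary in the induction.
    have e1 := ih (fun n => g (n + 1)) h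
    have e2 := ih g (fun n => h (n + 1))
    rw [smul_eq_mul] at key
    rw [← mul_right_inj' hj.ne', key, multiFactorial_add_single, hd,
      Finset.sum_antidiagonal_choose_succ_mul (fun m n => g m * h n)]
    have : ∀ A : ℝ, ((ν j : ℝ) + 1) * (A / (((ν j : ℝ) + 1) * multiFactorial ν)) =
        A / multiFactorial ν := by
      intro A
      have := (multiFactorial_pos ν).ne'
      field_simp
    rw [this, add_div, add_comm]
    have e3 : ∑ p ∈ HasAntidiagonal.antidiagonal ν.degree,
        (ν.degree.choose p.2 : ℝ) * (g (p.1 + 1) * h p.2) =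
        ∑ p ∈ HasAntidiagonal.antidiagonal ν.degree,
        (ν.degree.choose p.1 : ℝ) * (g (p.1 + 1) * h p.2) := by
      refine Finset.sum_congr rfl fun p hp => ?_
      rw [Nat.choose_symm_of_eq_add (HasAntidiagonal.mem_antidiagonal.1 hp).symm]
    rw [e3, ← e1, ← e2, Finset.sum_add_distrib]
    have hs : ∀ (κ : ℕ →₀ ℕ) (A : ℝ),
        ((κ j : ℝ) + 1) * (A / (((κ j : ℝ) + 1) * multiFactorial κ)) = A / multiFactorial κ := by
      intro κ A
      have h1 := (multiFactorial_pos κ).ne'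
      have h2 : (0 : ℝ) < (κ j : ℝ) + 1 := by positivity
      field_simp
    congr 1 <;> refine Finset.sum_congr rfl fun p _ => ?_
    · rw [multiFactorial_add_single, smul_eq_mul, ← mul_assoc, hs]
      simp
    · rw [multiFactorial_add_single, smul_eq_mul, mul_left_comm, hs]
      simp

/-! ### Coefficients of the inverse of a power series -/

section Inverse

open Finset

variable {A : Type*} [NormedRing A]

/-- If the coefficients of a power series depend differentiably on a parameter like Taylor
coefficients along a coordinate direction, then so do those of its inverse. -/
theorem hasDerivAt_inverse_coeff [NormedAlgebra ℝ A] [CompleteSpace A]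
    {B Q : ℝ → (ℕ →₀ ℕ) → A} {j : ℕ} {t₀ : ℝ}
    (hB : ∀ ν, HasDerivAt (fun t => B t ν)
      (((ν j : ℝ) + 1) • B t₀ (ν + Finsupp.single j 1)) t₀)
    (hu : ∀ t, IsUnit (B t 0))
    (hQ : ∀ t ν, ∑ p ∈ HasAntidiagonal.antidiagonal ν, B t p.1 * Q t p.2 = if ν = 0 then 1 else 0)
    (ν : ℕ →₀ ℕ) :
    HasDerivAt (fun t => Q t ν) (((ν j : ℝ) + 1) • Q t₀ (ν + Finsupp.single j 1)) t₀ := by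
  induction hn : ν.degree using Nat.strong_induction_on generalizing ν with
  | _ n ih =>
  have h0 : ((0 : ℕ →₀ ℕ), ν) ∈ HasAntidiagonal.antidiagonal ν := by simp
  have hlt : ∀ p ∈ (HasAntidiagonal.antidiagonal ν).erase (0, ν), p.2.degree < n := by
    rintro ⟨p, q⟩ hp
    rw [mem_erase, HasAntidiagonal.mem_antidiagonal] at hp
    obtain ⟨hp, rfl⟩ := hp
    have : p ≠ 0 := by rintro rfl; simp at hp
    have := mt (Finsupp.degree_eq_zero_iff p).1 this
    rw [← hn, map_add]
    dsimp only
    omega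
  -- Solving the convolution identity for its term of top order expresses `Q ν` through strictly
  -- lower orders, hence gives differentiability; the value of the derivative is found separately.
  have hrep : (fun t => Q t ν) = fun t => Ring.inverse (B t 0) *
      ((if ν = 0 then 1 else 0) -
        ∑ p ∈ (HasAntidiagonal.antidiagonal ν).erase (0, ν), B t p.1 * Q t p.2) := by
    funext t
    rw [← hQ t ν, ← add_sum_erase _ _ h0, add_sub_cancel_right,
      Ring.inverse_mul_cancel_left _ _ (hu t)]
  have hdiff : DifferentiableAt ℝ (fun t => Q t ν) t₀ := by
    rw [hrep]
    have hx' : DifferentiableAt ℝ Ring.inverse (B t₀ 0) := differentiableAt_inverse (hu t₀)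
    refine DifferentiableAt.mul (hx'.comp t₀ (f := fun t => B t 0) (hB 0).differentiableAt)
      ((differentiableAt_const _).sub (DifferentiableAt.fun_sum fun p hp =>
        (hB p.1).differentiableAt.mul (ih _ (hlt p hp) p.2 rfl).differentiableAt))
  have hD : ∀ p ∈ HasAntidiagonal.antidiagonal ν,
      HasDerivAt (fun t => Q t p.2) (deriv (fun t => Q t p.2) t₀) t₀ := by
    intro p hp
    by_cases h : p = (0, ν)
    · rw [h]; exact hdiff.hasDerivAt
    · exact (ih _ (hlt p (mem_erase.2 ⟨h, hp⟩)) p.2 rfl).differentiableAt.hasDerivAt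
  have h1 : HasDerivAt (fun t => ∑ p ∈ HasAntidiagonal.antidiagonal ν, B t p.1 * Q t p.2)
      (∑ p ∈ HasAntidiagonal.antidiagonal ν,
        ((((p.1 j : ℝ) + 1) • B t₀ (p.1 + Finsupp.single j 1)) * Q t₀ p.2 +
        B t₀ p.1 * deriv (fun t => Q t p.2) t₀)) t₀ :=
    HasDerivAt.fun_sum fun p hp => (hB p.1).mul (hD p hp)
  have h2 : HasDerivAt (fun t => ∑ p ∈ HasAntidiagonal.antidiagonal ν, B t p.1 * Q t p.2) 0 t₀ := by
    simp only [hQ]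
    exact hasDerivAt_const _ _
  have h3 := h1.unique h2
  -- The differentiated identity at `ν` and the identity at `ν + eⱼ` both vanish. By induction their
  -- terms agree except in the unknown derivative, which is freed by cancelling the unit `B t₀ 0`.
  have h4 := sum_antidiagonal_add_single (fun μ κ => B t₀ μ * Q t₀ κ) ν j
  rw [hQ, if_neg (by simp), smul_zero] at h4
  have h5 : B t₀ 0 * deriv (fun t => Q t ν) t₀ =
      B t₀ 0 * (((ν j : ℝ) + 1) • Q t₀ (ν + Finsupp.single j 1)) := by
    have h6 := h3.trans h4
    rw [← add_sum_erase _ _ h0, ← add_sum_erase _ _ h0] at h6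
    have h7 : ∀ p ∈ (HasAntidiagonal.antidiagonal ν).erase (0, ν),
        (((p.1 j : ℝ) + 1) • B t₀ (p.1 + Finsupp.single j 1)) * Q t₀ p.2 +
          B t₀ p.1 * deriv (fun t => Q t p.2) t₀ =
        ((p.1 j : ℝ) + 1) • (B t₀ (p.1 + Finsupp.single j 1) * Q t₀ p.2) +
          ((p.2 j : ℝ) + 1) • (B t₀ p.1 * Q t₀ (p.2 + Finsupp.single j 1)) := by
      intro p hp
      rw [(ih _ (hlt p hp) p.2 rfl).deriv, smul_mul_assoc, mul_smul_comm]
    rw [sum_congr rfl h7] at h6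
    have h8 := add_right_cancel h6
    rw [smul_mul_assoc] at h8
    rw [mul_smul_comm]
    exact add_left_cancel h8
  rw [← (hu t₀).mul_left_cancel h5]
  exact hdiff.hasDerivAt

theorem exists_inverse_coeff {R : Type*} [Ring R] {B : (ℕ →₀ ℕ) → R} (hu : IsUnit (B 0)) :
    ∃ Q : (ℕ →₀ ℕ) → R, ∀ ν,
      ∑ p ∈ HasAntidiagonal.antidiagonal ν, B p.1 * Q p.2 = if ν = 0 then 1 else 0 := by
  classical
  obtain ⟨u, hu⟩ := hu
  let φ : MvPowerSeries ℕ R := B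
  refine ⟨MvPowerSeries.invOfUnit φ u, fun ν => ?_⟩
  have h := congrArg (MvPowerSeries.coeff ν) (MvPowerSeries.mul_invOfUnit φ u hu.symm)
  rw [MvPowerSeries.coeff_mul, MvPowerSeries.coeff_one] at h
  exact h

/-- `θ₀ = 1` and `θₙ = C (C + 1)ⁿ⁻¹` for `n ≥ 1`. -/
def gevreyFactor (C : ℝ) (n : ℕ) : ℝ := if n = 0 then 1 else C * (C + 1) ^ (n - 1)

theorem gevreyFactor_nonneg {C : ℝ} (hC : 0 ≤ C) (n : ℕ) : 0 ≤ gevreyFactor C n := by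
  unfold gevreyFactor; split_ifs <;> positivity

/-- The factor is chosen for this identity: `θₙ₊₁` is `C` times the sum of all its predecessors. -/
theorem sum_gevreyFactor (C : ℝ) (n : ℕ) :
    ∑ k ∈ range (n + 1), gevreyFactor C k = (C + 1) ^ n := by
  induction n with
  | zero => simp [gevreyFactor]
  | succ n ih =>
    rw [sum_range_succ, ih, gevreyFactor, if_neg (by omega), Nat.add_sub_cancel]
    ring

/-- Raise `n! = (n choose m) m! k!` to the power `σ`; a binomial coefficient is at least `1`, so it
is at most its `σ`-th power. -/
theorem choose_mul_rpow_factorial_le {σ : ℝ} (hσ : 1 ≤ σ) {m k n : ℕ} (h : m + k = n) :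
    (n.choose m : ℝ) * ((m.factorial : ℝ) ^ σ * (k.factorial : ℝ) ^ σ) ≤
      (n.factorial : ℝ) ^ σ := by
  subst h
  have h1 : ((m + k).factorial : ℝ) =
      ((m + k).choose m : ℝ) * ((m.factorial : ℝ) * (k.factorial : ℝ)) := by
    have := Nat.add_choose_mul_factorial_mul_factorial m k
    rw [← this, Nat.choose_symm_add]
    push_cast
    ring
  rw [h1, Real.mul_rpow (by positivity) (by positivity),
    Real.mul_rpow (by positivity) (by positivity)]
  gcongr
  have : (1 : ℝ) ≤ ((m + k).choose m : ℝ) := by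
    exact_mod_cast Nat.choose_pos (Nat.le_add_right m k)
  simpa using Real.rpow_le_rpow_of_exponent_le this hσ

theorem sum_choose_gevreyFactor_le {σ C : ℝ} (hσ : 1 ≤ σ) (hC : 0 ≤ C) {n : ℕ} (hn : n ≠ 0) :
    ∑ p ∈ HasAntidiagonal.antidiagonal n, (n.choose p.1 : ℝ) *
      ((if p.1 = 0 then 0 else C * (p.1.factorial : ℝ) ^ σ) *
        (gevreyFactor C p.2 * (p.2.factorial : ℝ) ^ σ)) ≤
      gevreyFactor C n * (n.factorial : ℝ) ^ σ := by
  obtain ⟨n, rfl⟩ := Nat.exists_eq_succ_of_ne_zero hn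
  have h1 : ∀ p ∈ HasAntidiagonal.antidiagonal (n + 1), ((n + 1).choose p.1 : ℝ) *
      ((if p.1 = 0 then 0 else C * (p.1.factorial : ℝ) ^ σ) *
        (gevreyFactor C p.2 * (p.2.factorial : ℝ) ^ σ)) ≤
      ((n + 1).factorial : ℝ) ^ σ * (C * if p.1 = 0 then 0 else gevreyFactor C p.2) := by
    intro p hp
    split_ifs with h
    · simp
    · have := choose_mul_rpow_factorial_le hσ (HasAntidiagonal.mem_antidiagonal.1 hp)
      have h2 := mul_le_mul_of_nonneg_right this
        (mul_nonneg hC (gevreyFactor_nonneg hC p.2))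
      linarith
  refine (sum_le_sum h1).trans (le_of_eq ?_)
  -- The split-off pair `(0, n + 1)` contributes zero, leaving `C (θ₀ + ⋯ + θₙ) = C (C + 1)ⁿ`.
  rw [← mul_sum, ← mul_sum, Nat.sum_antidiagonal_succ]
  simp only [if_pos, zero_add, Nat.succ_ne_zero, if_false]
  rw [sum_antidiagonal_prodComm, Nat.sum_antidiagonal_eq_sum_range_succ_mk]
  simp only [Prod.snd_swap]
  rw [sum_gevreyFactor, gevreyFactor]
  simp
  ring

/-- Since `B 0 = 1`, the recursion for `Q` involves no inverse, so no constant beyond `C` enters;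
what remains is the scalar recursion solved by `gevreyFactor`. -/
theorem norm_inverse_coeff_le {B Q : (ℕ →₀ ℕ) → A} {b : ℕ → ℝ} {σ C : ℝ} (hσ : 1 ≤ σ) (hC : 0 ≤ C)
    (hb : ∀ j, 0 ≤ b j) (h1 : ‖(1 : A)‖ ≤ 1) (hB0 : B 0 = 1)
    (hB : ∀ ν, ‖B ν‖ ≤ C * (ν.degree.factorial : ℝ) ^ σ / multiFactorial ν * multiPow b ν)
    (hQ : ∀ ν, ∑ p ∈ HasAntidiagonal.antidiagonal ν, B p.1 * Q p.2 = if ν = 0 then 1 else 0)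
    (ν : ℕ →₀ ℕ) :
    ‖Q ν‖ ≤ gevreyFactor C ν.degree * (ν.degree.factorial : ℝ) ^ σ / multiFactorial ν *
      multiPow b ν := by
  induction hn : ν.degree using Nat.strong_induction_on generalizing ν with
  | _ n ih =>
  by_cases hν : ν = 0
  · subst hν
    have := hQ 0
    simp [hB0] at this
    simp at hn
    simp [this, ← hn, gevreyFactor, multiFactorial_zero, multiPow_zero, h1]
  have h0 : ((0 : ℕ →₀ ℕ), ν) ∈ HasAntidiagonal.antidiagonal ν := by simp
  have hne : ∀ p ∈ (HasAntidiagonal.antidiagonal ν).erase (0, ν), p.1.degree ≠ 0 := by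
    rintro ⟨p, q⟩ hp
    rw [mem_erase, HasAntidiagonal.mem_antidiagonal] at hp
    obtain ⟨hp, rfl⟩ := hp
    have : p ≠ 0 := by rintro rfl; simp at hp
    exact mt (Finsupp.degree_eq_zero_iff p).1 this
  have hrep : Q ν = -∑ p ∈ (HasAntidiagonal.antidiagonal ν).erase (0, ν), B p.1 * Q p.2 := by
    have := hQ ν
    rw [← add_sum_erase _ _ h0, hB0, one_mul, if_neg hν] at this
    exact eq_neg_of_add_eq_zero_left this
  have hn0 : n ≠ 0 := by
    rw [← hn]; exact mt (Finsupp.degree_eq_zero_iff ν).1 hν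
  calc ‖Q ν‖ ≤ ∑ p ∈ (HasAntidiagonal.antidiagonal ν).erase (0, ν), ‖B p.1‖ * ‖Q p.2‖ := by
        rw [hrep, norm_neg]
        exact (norm_sum_le _ _).trans (sum_le_sum fun p _ => norm_mul_le _ _)
    _ ≤ ∑ p ∈ (HasAntidiagonal.antidiagonal ν).erase (0, ν), multiPow b ν *
          ((if p.1.degree = 0 then 0 else C * (p.1.degree.factorial : ℝ) ^ σ) /
              multiFactorial p.1 *
            (gevreyFactor C p.2.degree * (p.2.degree.factorial : ℝ) ^ σ / multiFactorial p.2)) := by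
        refine sum_le_sum fun p hp => ?_
        have hp0 := hne p hp
        have hp2 := HasAntidiagonal.mem_antidiagonal.1 (mem_erase.1 hp).2
        have hlt : p.2.degree < n := by
          rw [← hn, ← hp2, map_add]; omega
        rw [if_neg hp0]
        refine (mul_le_mul (hB p.1) (ih _ hlt p.2 rfl) (norm_nonneg _) ?_).trans (le_of_eq ?_)
        · exact (norm_nonneg _).trans (hB p.1)
        · rw [← hp2, multiPow_add]; ring
    -- The `if` makes the omitted pair `(0, ν)` contribute zero, so the full sum required by the
    -- Vandermonde identity is available.
    _ = ∑ p ∈ HasAntidiagonal.antidiagonal ν, multiPow b ν *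
          ((if p.1.degree = 0 then 0 else C * (p.1.degree.factorial : ℝ) ^ σ) /
              multiFactorial p.1 *
            (gevreyFactor C p.2.degree * (p.2.degree.factorial : ℝ) ^ σ / multiFactorial p.2)) := by
        rw [← add_sum_erase _ _ h0]; simp
    _ ≤ _ := by
        rw [← mul_sum, sum_antidiagonal_multiFactorial ν
          (fun m => if m = 0 then 0 else C * (m.factorial : ℝ) ^ σ)
          (fun m => gevreyFactor C m * (m.factorial : ℝ) ^ σ), hn, mul_comm]
        refine mul_le_mul_of_nonneg_right ?_ (multiPow_nonneg hb ν)
        exact div_le_div_of_nonneg_right (sum_choose_gevreyFactor_le hσ hC hn0)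
          (multiFactorial_pos ν).le

end Inverse

/-! ### Recognising mixed partial derivatives -/

section MixedPartial

variable {E : Type*} [NormedAddCommGroup E] [NormedSpace ℝ E]

theorem mixedPartial_zero (g : (ℕ → ℝ) → E) : mixedPartial 0 g = g := by
  simp [mixedPartial]

/-- A family which starts with `g` and whose members are the partial derivatives of one another
consists of the mixed partial derivatives of `g`. -/
theorem mixedPartial_eq_of_hasDerivAt {X : Set (ℕ → ℝ)}
    (hX : ∀ y ∈ X, ∀ j t, Function.update y j t ∈ X) {g : (ℕ → ℝ) → E}
    {W : (ℕ →₀ ℕ) → (ℕ → ℝ) → E} (h0 : ∀ y ∈ X, g y = W 0 y)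
    (hW : ∀ ν, ∀ y ∈ X, ∀ j, HasDerivAt (fun t : ℝ => W ν (Function.update y j t))
      (W (ν + Finsupp.single j 1) y) (y j)) (ν : ℕ →₀ ℕ) :
    ∀ y ∈ X, mixedPartial ν g y = W ν y := by
  have step : ∀ (μ : ℕ →₀ ℕ) (h : (ℕ → ℝ) → E) (j n : ℕ), (∀ y ∈ X, h y = W μ y) →
      ∀ y ∈ X, (partialDeriv j)^[n] h y = W (μ + Finsupp.single j n) y := by
    intro μ h j n hh
    induction n with
    | zero => simpa using hh
    | succ n ih =>
      intro y hy
      rw [Function.iterate_succ_apply', partialDeriv]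
      -- Agreement on `X` holds along the whole coordinate line, since `X` is stable under changing
      -- one coordinate; so it survives `deriv`.
      have : (fun t : ℝ => (partialDeriv j)^[n] h (Function.update y j t)) =
          fun t => W (μ + Finsupp.single j n) (Function.update y j t) :=
        funext fun t => ih _ (hX y hy j t)
      rw [this, (hW _ y hy j).deriv, add_assoc, ← Finsupp.single_add]
  have fold : ∀ l : List ℕ, ∀ y ∈ X, l.foldr (fun j h => (partialDeriv j)^[ν j] h) g y =
      W ((l.map fun j => Finsupp.single j (ν j)).sum) y := by
    intro l
    induction l with
    | nil => simpa using h0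
    | cons j l ih =>
      intro y hy
      rw [List.foldr_cons, step _ _ _ _ ih y hy, List.map_cons, List.sum_cons, add_comm]
  intro y hy
  rw [mixedPartial, fold _ y hy]
  congr 1
  have h1 : (((ν.support.sort (· ≤ ·)).map fun j => Finsupp.single j (ν j)).sum) =
      ν.support.sum fun j => Finsupp.single j (ν j) := by
    rw [Finset.sum, ← Multiset.sum_coe, ← Multiset.map_coe, Finset.sort_eq]
  rw [h1]
  exact ν.sum_single

end MixedPartial


/-! ### Calculus on the line -/

/-- Gronwall in both directions: `exp(-K r) g(r)` decreases and `exp(K r) g(r)` increases. -/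
theorem le_exp_mul_of_abs_deriv_le {g g' : ℝ → ℝ} {K : ℝ} (hg : ∀ t, HasDerivAt g (g' t) t)
    (hK : ∀ t, |g' t| ≤ K * g t) (s t : ℝ) : g t ≤ Real.exp (K * |t - s|) * g s := by
  have hexp : ∀ (k : ℝ) (r : ℝ), HasDerivAt (fun r => Real.exp (k * r) * g r)
      (Real.exp (k * r) * (k * g r + g' r)) r := by
    intro k r
    have h1 : HasDerivAt (fun r => Real.exp (k * r)) (Real.exp (k * r) * k) r := by
      simpa using ((hasDerivAt_id r).const_mul k).exp
    exact (h1.mul (hg r)).congr_deriv (by ring)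
  have hmul : ∀ k : ℝ, Real.exp (k * t) * g t ≤ Real.exp (k * s) * g s →
      g t ≤ Real.exp (k * (s - t)) * g s := by
    intro k h
    rw [mul_sub, Real.exp_sub, div_mul_eq_mul_div, le_div_iff₀ (Real.exp_pos _)]
    linarith
  rcases le_total s t with h | h
  · have hanti : Antitone fun r => Real.exp (-K * r) * g r := by
      refine antitone_of_deriv_nonpos (fun r => (hexp (-K) r).differentiableAt) fun r => ?_
      rw [(hexp (-K) r).deriv]
      refine mul_nonpos_of_nonneg_of_nonpos (Real.exp_pos _).le ?_
      linarith [(abs_le.1 (hK r)).2]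
    have := hmul (-K) (hanti h)
    rwa [abs_of_nonneg (sub_nonneg.2 h), show K * (t - s) = -K * (s - t) by ring]
  · have hmono : Monotone fun r => Real.exp (K * r) * g r := by
      refine monotone_of_deriv_nonneg (fun r => (hexp K r).differentiableAt) fun r => ?_
      rw [(hexp K r).deriv]
      refine mul_nonneg (Real.exp_pos _).le ?_
      linarith [(abs_le.1 (hK r)).1]
    have := hmul K (hmono h)
    rwa [abs_of_nonpos (sub_nonpos.2 h), neg_sub]

/-- Two applications of the mean value inequality, first to `g'` and then to `g` minus its linear
part; the factor `1/2` is not needed. -/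
theorem abs_taylor_two_le {g g' g'' : ℝ → ℝ} {M s t : ℝ} (hg : ∀ r, HasDerivAt g (g' r) r)
    (hg' : ∀ r, HasDerivAt g' (g'' r) r) (hM : ∀ r, |r - s| ≤ |t - s| → |g'' r| ≤ M) :
    |g t - g s - (t - s) * g' s| ≤ M * (t - s) ^ 2 := by
  have hconv : Convex ℝ (Metric.closedBall s |t - s|) := convex_closedBall _ _
  have hs : s ∈ Metric.closedBall s |t - s| := by simp
  have ht : t ∈ Metric.closedBall s |t - s| := by simp [Real.dist_eq]
  have hM0 : 0 ≤ M := (abs_nonneg _).trans (hM s (by simp))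
  have h1 : ∀ r ∈ Metric.closedBall s |t - s|, ‖g' r - g' s‖ ≤ M * |t - s| := by
    intro r hr
    refine (hconv.norm_image_sub_le_of_norm_hasDerivWithin_le (C := M)
      (fun r _ => (hg' r).hasDerivWithinAt) (fun r hr => ?_) hs hr).trans ?_
    · exact hM r (by simpa [Real.dist_eq] using hr)
    · gcongr
      simpa [Real.dist_eq] using hr
  have h2 := hconv.norm_image_sub_le_of_norm_hasDerivWithin_le
    (f := fun r => g r - r * g' s) (f' := fun r => g' r - g' s)
    (fun r _ => ((hg r).sub (by simpa using (hasDerivAt_id r).mul_const (g' s))).hasDerivWithinAt)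
    h1 hs ht
  rw [Real.norm_eq_abs, Real.norm_eq_abs, mul_assoc, abs_mul_abs_self] at h2
  convert h2 using 1
  · congr 1; ring
  · ring

/-! ### Relative bounds for the coefficient -/

theorem update_mem_paramSet {α : ℕ → ℝ} {τ : ℝ} {y : ℕ → ℝ} (hy : y ∈ paramSet α τ) (j : ℕ)
    (t : ℝ) : Function.update y j t ∈ paramSet α τ := by
  refine Summable.congr_cofinite (f := fun i => α i * |y i| ^ τ) hy ?_
  filter_upwards [(Set.finite_singleton j).compl_mem_cofinite] with i hi
  rw [Function.update_of_ne (by simpa using hi)]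

theorem HasAllMixedPartials.hasDerivAt_update {E : Type*} [NormedAddCommGroup E] [NormedSpace ℝ E]
    {U : Set (ℕ → ℝ)} {g : (ℕ → ℝ) → E} (h : HasAllMixedPartials U g)
    (hU : ∀ y ∈ U, ∀ j t, Function.update y j t ∈ U) {y : ℕ → ℝ} (hy : y ∈ U) (ν : ℕ →₀ ℕ) (j : ℕ)
    (t : ℝ) : HasDerivAt (fun t : ℝ => mixedPartial ν g (Function.update y j t))
      (mixedPartial (ν + Finsupp.single j 1) g (Function.update y j t)) t := by
  simpa using h ν _ (hU y hy j t) j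

/-- The constant in the bound for the relative derivatives of a coefficient. -/
def gevreyBound (σ C : ℝ) (b : ℕ → ℝ) (ν : ℕ →₀ ℕ) : ℝ :=
  C * (ν.degree.factorial : ℝ) ^ σ * multiPow b ν

namespace IsGevreyCoefficient

variable {d : ℕ} {D : BoundedOpen d} {U : Set (ℕ → ℝ)}
  {a : EuclideanSpace ℝ (Fin d) → (ℕ → ℝ) → ℝ} {σ C : ℝ} {b : ℕ → ℝ}

theorem gevreyBound_nonneg (hG : IsGevreyCoefficient D U a σ C b) (ν : ℕ →₀ ℕ) :
    0 ≤ gevreyBound σ C b ν :=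
  mul_nonneg (mul_nonneg hG.C_pos.le (by positivity)) (multiPow_nonneg hG.b_nonneg ν)

theorem ae_abs_le (hG : IsGevreyCoefficient D U a σ C b)
    (hpos : ∀ x ∈ D.carrier, ∀ y ∈ U, 0 < a x y) {y : ℕ → ℝ} (hy : y ∈ U) (ν : ℕ →₀ ℕ) :
    ∀ᵐ x ∂D.vol, |mixedPartial ν (a x) y| ≤ gevreyBound σ C b ν * a x y := by
  have h : _ ≤ ENNReal.ofReal (gevreyBound σ C b ν) := hG.bound y hy ν
  rw [eLpNorm_exponent_top] at h
  filter_upwards [ae_le_eLpNormEssSup (f := fun x => mixedPartial ν (a x) y / a x y)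
    (μ := D.vol), ae_restrict_mem D.isOpen.measurableSet] with x hx hxD
  have h2 := hx.trans h
  rw [← ofReal_norm, ENNReal.ofReal_le_ofReal_iff (hG.gevreyBound_nonneg ν),
    Real.norm_eq_abs, abs_div, abs_of_pos (hpos x hxD y hy),
    div_le_iff₀ (hpos x hxD y hy)] at h2
  exact h2

/-- Each further derivative is a pointwise limit of difference quotients along the steps `1/(n +
1)`. -/
theorem aestronglyMeasurable_mixedPartial (hG : IsGevreyCoefficient D U a σ C b)
    (hU : ∀ y ∈ U, ∀ j t, Function.update y j t ∈ U) (ν : ℕ →₀ ℕ) :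
    ∀ y ∈ U, AEStronglyMeasurable (fun x => mixedPartial ν (a x) y) D.vol := by
  induction ν using multiIndex_induction with
  | h0 =>
    simp only [mixedPartial_zero]
    exact hG.measurable
  | hs ν j ih =>
    intro y hy
    refine aestronglyMeasurable_of_tendsto_ae atTop
      (f := fun (n : ℕ) x => (1 / ((n : ℝ) + 1))⁻¹ •
        (mixedPartial ν (a x) (Function.update y j (y j + 1 / ((n : ℝ) + 1))) -
          mixedPartial ν (a x) (Function.update y j (y j))))
      (fun n => ((ih _ (hU y hy j (y j + 1 / ((n : ℝ) + 1)))).sub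
        (ih _ (hU y hy j (y j)))).const_smul (1 / ((n : ℝ) + 1))⁻¹) ?_
    filter_upwards [ae_restrict_mem D.isOpen.measurableSet] with x hxD
    have h1 := hasDerivAt_iff_tendsto_slope_zero.1 (hG.smooth x hxD ν y hy j)
    refine h1.comp (tendsto_nhdsWithin_iff.2 ⟨tendsto_one_div_add_atTop_nhds_zero_nat, ?_⟩)
    refine Eventually.of_forall fun n => ?_
    have : (0 : ℝ) < 1 / ((n : ℝ) + 1) := by positivity
    exact this.ne'

/-- The exceptional null set in (A1) depends on the parameter. Rational `t` give one common null
set, and continuity in `t` extends the inequality to all real `t`. -/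
theorem ae_forall_abs_le
    (hG : IsGevreyCoefficient D U a σ C b)
    (hpos : ∀ x ∈ D.carrier, ∀ y ∈ U, 0 < a x y)
    (hU : ∀ y ∈ U, ∀ j t, Function.update y j t ∈ U)
    {y : ℕ → ℝ} (hy : y ∈ U) (ν : ℕ →₀ ℕ) (j : ℕ) :
    ∀ᵐ x ∂D.vol, ∀ t : ℝ, |mixedPartial ν (a x) (Function.update y j t)| ≤
      gevreyBound σ C b ν * a x (Function.update y j t) := by
  have h : ∀ᵐ x ∂D.vol, ∀ q : ℚ, |mixedPartial ν (a x) (Function.update y j (q : ℝ))| ≤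
      gevreyBound σ C b ν * a x (Function.update y j (q : ℝ)) :=
    ae_all_iff.2 fun q => hG.ae_abs_le hpos (hU y hy j q) ν
  filter_upwards [h, ae_restrict_mem D.isOpen.measurableSet] with x hx hxD t
  have hc : ∀ μ : ℕ →₀ ℕ, Continuous fun t : ℝ => mixedPartial μ (a x) (Function.update y j t) :=
    fun μ => continuous_iff_continuousAt.2 fun t =>
      ((hG.smooth x hxD).hasDerivAt_update hU hy μ j t).continuousAt
  have hc0 : Continuous fun t : ℝ => a x (Function.update y j t) := by
    simpa only [mixedPartial_zero] using hc 0
  refine Rat.denseRange_cast.induction_on (p := fun t : ℝ =>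
    |mixedPartial ν (a x) (Function.update y j t)| ≤
      gevreyBound σ C b ν * a x (Function.update y j t)) t ?_ hx
  exact isClosed_le (hc ν).abs (continuous_const.mul hc0)

theorem ae_forall_le_exp
    (hG : IsGevreyCoefficient D U a σ C b)
    (hpos : ∀ x ∈ D.carrier, ∀ y ∈ U, 0 < a x y)
    (hU : ∀ y ∈ U, ∀ j t, Function.update y j t ∈ U)
    {y : ℕ → ℝ} (hy : y ∈ U) (j : ℕ) :
    ∀ᵐ x ∂D.vol, ∀ s t : ℝ, a x (Function.update y j t) ≤
      Real.exp (gevreyBound σ C b (Finsupp.single j 1) * |t - s|) *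
        a x (Function.update y j s) := by
  filter_upwards [hG.ae_forall_abs_le hpos hU hy (Finsupp.single j 1) j,
    ae_restrict_mem D.isOpen.measurableSet] with x hx hxD s t
  refine le_exp_mul_of_abs_deriv_le (g := fun t => a x (Function.update y j t)) (fun t => ?_) hx s t
  simpa only [mixedPartial_zero, zero_add] using
    (hG.smooth x hxD).hasDerivAt_update hU hy 0 j t

end IsGevreyCoefficient

/-! ### The coefficient relative to its value at a base point -/

/-- The parameters in `U` at which the coefficient is comparable to the one at `y₀`. -/
def comparableSet {d : ℕ} (D : BoundedOpen d) (U : Set (ℕ → ℝ))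
    (a : EuclideanSpace ℝ (Fin d) → (ℕ → ℝ) → ℝ) (y₀ : ℕ → ℝ) : Set (ℕ → ℝ) :=
  {y | y ∈ U ∧ ∃ K : ℝ, 0 < K ∧ ∀ᵐ x ∂D.vol, a x y ≤ K * a x y₀ ∧ a x y₀ ≤ K * a x y}

open Classical in
/-- `∂ᵛa(·,y) / a(·,y₀)` as an element of `L^∞(D)`. -/
def relativePartial {d : ℕ} (D : BoundedOpen d) (a : EuclideanSpace ℝ (Fin d) → (ℕ → ℝ) → ℝ)
    (y₀ : ℕ → ℝ) (ν : ℕ →₀ ℕ) (y : ℕ → ℝ) : Lp ℝ ⊤ D.vol :=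
  if h : MemLp (fun x => mixedPartial ν (a x) y / a x y₀) ⊤ D.vol then h.toLp else 0

theorem norm_Lp_top_le {X E : Type*} [MeasurableSpace X] [NormedAddCommGroup E] {μ : Measure X}
    {f : Lp E ⊤ μ} {K : ℝ} (hK : 0 ≤ K) (h : ∀ᵐ x ∂μ, ‖f x‖ ≤ K) : ‖f‖ ≤ K := by
  rw [Lp.norm_def, eLpNorm_exponent_top]
  exact ENNReal.toReal_le_of_le_ofReal hK (eLpNormEssSup_le_of_ae_bound h)

theorem hasDerivAt_of_norm_le_sq {E : Type*} [NormedAddCommGroup E] [NormedSpace ℝ E] {F : ℝ → E}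
    {F' : E} {t₀ M : ℝ}
    (h : ∀ t, |t - t₀| ≤ 1 → ‖F t - F t₀ - (t - t₀) • F'‖ ≤ M * (t - t₀) ^ 2) :
    HasDerivAt F F' t₀ := by
  rw [hasDerivAt_iff_isLittleO]
  have h1 : (fun t => F t - F t₀ - (t - t₀) • F') =O[nhds t₀] fun t => (t - t₀) ^ 2 := by
    refine Asymptotics.IsBigO.of_bound M ?_
    filter_upwards [Metric.closedBall_mem_nhds t₀ one_pos] with t ht
    rw [norm_pow, Real.norm_eq_abs, sq_abs]
    exact h t (by simpa [Real.dist_eq] using ht)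
  refine h1.trans_isLittleO ?_
  simpa using Asymptotics.isLittleO_pow_sub_sub t₀ (one_lt_two)

namespace IsGevreyCoefficient

variable {d : ℕ} {D : BoundedOpen d} {U : Set (ℕ → ℝ)}
  {a : EuclideanSpace ℝ (Fin d) → (ℕ → ℝ) → ℝ} {σ C : ℝ} {b : ℕ → ℝ}

/-- Moving one coordinate costs only a factor `exp(k |t - yⱼ|)`, uniform in `x`. Partial
differentiation therefore never leaves the comparable set. -/
theorem update_mem_comparableSet
    (hG : IsGevreyCoefficient D U a σ C b)
    (hpos : ∀ x ∈ D.carrier, ∀ y ∈ U, 0 < a x y)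
    (hU : ∀ y ∈ U, ∀ j t, Function.update y j t ∈ U)
    {y₀ y : ℕ → ℝ}
    (hy : y ∈ comparableSet D U a y₀) (j : ℕ) (t : ℝ) :
    Function.update y j t ∈ comparableSet D U a y₀ := by
  obtain ⟨hyU, K, hK, h⟩ := hy
  refine ⟨hU y hyU j t, Real.exp (gevreyBound σ C b (Finsupp.single j 1) * |t - y j|) * K,
    mul_pos (Real.exp_pos _) hK, ?_⟩
  filter_upwards [h, hG.ae_forall_le_exp hpos hU hyU j] with x ⟨hx1, hx2⟩ hx3
  have h1 := hx3 (y j) t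
  have h2 := hx3 t (y j)
  rw [Function.update_eq_self] at h1 h2
  rw [abs_sub_comm] at h2
  constructor
  · refine h1.trans ?_
    rw [mul_assoc]
    gcongr
  · refine hx2.trans ?_
    rw [mul_comm _ K, mul_assoc]
    gcongr

theorem memLp_relative
    (hG : IsGevreyCoefficient D U a σ C b)
    (hpos : ∀ x ∈ D.carrier, ∀ y ∈ U, 0 < a x y)
    (hU : ∀ y ∈ U, ∀ j t, Function.update y j t ∈ U)
    {y₀ y : ℕ → ℝ} (hy₀ : y₀ ∈ U) (hy : y ∈ comparableSet D U a y₀)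
    (ν : ℕ →₀ ℕ) : MemLp (fun x => mixedPartial ν (a x) y / a x y₀) ⊤ D.vol := by
  obtain ⟨hyU, K, hK, h⟩ := hy
  refine memLp_top_of_bound ((hG.aestronglyMeasurable_mixedPartial hU ν y
    hyU).aemeasurable.div (hG.measurable y₀ hy₀).aemeasurable).aestronglyMeasurable
    (gevreyBound σ C b ν * K) ?_
  filter_upwards [h, hG.ae_abs_le hpos hyU ν, ae_restrict_mem D.isOpen.measurableSet]
    with x ⟨hx1, _⟩ hx2 hxD
  have h0 := hpos x hxD y₀ hy₀
  rw [norm_div, Real.norm_eq_abs, Real.norm_eq_abs, abs_of_pos h0, div_le_iff₀ h0, mul_assoc]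
  exact hx2.trans (mul_le_mul_of_nonneg_left hx1 (hG.gevreyBound_nonneg ν))

theorem coeFn_relativePartial
    (hG : IsGevreyCoefficient D U a σ C b)
    (hpos : ∀ x ∈ D.carrier, ∀ y ∈ U, 0 < a x y)
    (hU : ∀ y ∈ U, ∀ j t, Function.update y j t ∈ U)
    {y₀ y : ℕ → ℝ} (hy₀ : y₀ ∈ U) (hy : y ∈ comparableSet D U a y₀)
    (ν : ℕ →₀ ℕ) :
    relativePartial D a y₀ ν y =ᵐ[D.vol] fun x => mixedPartial ν (a x) y / a x y₀ := by
  rw [relativePartial, dif_pos (hG.memLp_relative hpos hU hy₀ hy ν)]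
  exact MemLp.coeFn_toLp _

/-- At the base point the comparison constant is absent, so the bound of (A1) is inherited exactly;
this keeps `C` in the final estimate. -/
theorem norm_relativePartial_le
    (hG : IsGevreyCoefficient D U a σ C b)
    (hpos : ∀ x ∈ D.carrier, ∀ y ∈ U, 0 < a x y)
    (hU : ∀ y ∈ U, ∀ j t, Function.update y j t ∈ U)
    {y₀ : ℕ → ℝ} (hy₀ : y₀ ∈ U) (hy : y₀ ∈ comparableSet D U a y₀)
    (ν : ℕ →₀ ℕ) : ‖relativePartial D a y₀ ν y₀‖ ≤ gevreyBound σ C b ν := by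
  refine norm_Lp_top_le (hG.gevreyBound_nonneg ν) ?_
  filter_upwards [hG.coeFn_relativePartial hpos hU hy₀ hy ν, hG.ae_abs_le hpos hy₀ ν,
    ae_restrict_mem D.isOpen.measurableSet] with x hx1 hx2 hxD
  have h0 := hpos x hxD y₀ hy₀
  rwa [hx1, norm_div, Real.norm_eq_abs, Real.norm_eq_abs, abs_of_pos h0, div_le_iff₀ h0]

/-- Pointwise differentiability becomes differentiability in `L^∞(D)` because the second derivative
along the line, relative to `a(·,y₀)`, is bounded uniformly in `x`, giving a uniform quadratic
remainder. -/
theorem hasDerivAt_relativePartial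
    (hG : IsGevreyCoefficient D U a σ C b)
    (hpos : ∀ x ∈ D.carrier, ∀ y ∈ U, 0 < a x y)
    (hU : ∀ y ∈ U, ∀ j t, Function.update y j t ∈ U)
    {y₀ y : ℕ → ℝ} (hy₀ : y₀ ∈ U) (hy : y ∈ comparableSet D U a y₀)
    (ν : ℕ →₀ ℕ) (j : ℕ) :
    HasDerivAt (fun t : ℝ => relativePartial D a y₀ ν (Function.update y j t))
      (relativePartial D a y₀ (ν + Finsupp.single j 1) y) (y j) := by
  obtain ⟨hyU, K, hK, hcomp⟩ := id hy
  set k := gevreyBound σ C b (Finsupp.single j 1)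
  set N := gevreyBound σ C b (ν + Finsupp.single j 1 + Finsupp.single j 1)
  have hk : 0 ≤ k := hG.gevreyBound_nonneg _
  have hN : 0 ≤ N := hG.gevreyBound_nonneg _
  -- `N` bounds the second derivative relative to `a` at the same point, `exp k` compares that point
  -- with `y` over a distance of at most `1`, and `K` compares `y` with `y₀`.
  refine hasDerivAt_of_norm_le_sq (M := N * (Real.exp k * K)) fun t ht => ?_
  refine norm_Lp_top_le (by positivity) ?_
  have hyt := hG.update_mem_comparableSet hpos hU hy j t
  have hys := hG.update_mem_comparableSet hpos hU hy j (y j)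
  filter_upwards [Lp.coeFn_sub (relativePartial D a y₀ ν (Function.update y j t) -
      relativePartial D a y₀ ν (Function.update y j (y j)))
      ((t - y j) • relativePartial D a y₀ (ν + Finsupp.single j 1) y),
    Lp.coeFn_sub (relativePartial D a y₀ ν (Function.update y j t))
      (relativePartial D a y₀ ν (Function.update y j (y j))),
    Lp.coeFn_smul (t - y j) (relativePartial D a y₀ (ν + Finsupp.single j 1) y),
    hG.coeFn_relativePartial hpos hU hy₀ hyt ν, hG.coeFn_relativePartial hpos hU hy₀ hys ν,
    hG.coeFn_relativePartial hpos hU hy₀ hy (ν + Finsupp.single j 1), hcomp,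
    hG.ae_forall_le_exp hpos hU hyU j,
    hG.ae_forall_abs_le hpos hU hyU (ν + Finsupp.single j 1 + Finsupp.single j 1) j,
    ae_restrict_mem D.isOpen.measurableSet] with x h1 h2 h3 h4 h5 h6 ⟨h7, _⟩ h8 h9 hxD
  have h0 := hpos x hxD y₀ hy₀
  rw [h1, Pi.sub_apply, h2, Pi.sub_apply, h3, Pi.smul_apply, h4, h5, h6, smul_eq_mul,
    ← mul_div_assoc, ← sub_div, ← sub_div, norm_div, Real.norm_eq_abs, Real.norm_eq_abs,
    abs_of_pos h0, div_le_iff₀ h0]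
  have hT := abs_taylor_two_le (s := y j) (t := t) (M := N * (Real.exp k * K * a x y₀))
    (fun r => (hG.smooth x hxD).hasDerivAt_update hU hyU ν j r)
    (fun r => (hG.smooth x hxD).hasDerivAt_update hU hyU (ν + Finsupp.single j 1) j r) ?_
  · rw [Function.update_eq_self] at hT ⊢
    refine hT.trans (le_of_eq ?_)
    ring
  · intro r hr
    refine (h9 r).trans (mul_le_mul_of_nonneg_left ?_ hN)
    have h10 := h8 (y j) r
    rw [Function.update_eq_self] at h10
    refine h10.trans ?_
    rw [mul_assoc]
    have h11 : k * |r - y j| ≤ k := by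
      simpa using mul_le_mul_of_nonneg_left (hr.trans ht) hk
    refine mul_le_mul (Real.exp_le_exp.2 h11) h7 (hpos x hxD y hyU).le (Real.exp_pos _).le

end IsGevreyCoefficient


/-! ### Compressions of operators -/

section Compression

variable {H : Type*} [NormedAddCommGroup H] [InnerProductSpace ℝ H] [CompleteSpace H]
  (S : Submodule ℝ H) [CompleteSpace S]

theorem norm_adjoint_subtypeL_comp_le (T : H →L[ℝ] H) :
    ‖(ContinuousLinearMap.adjoint S.subtypeL) ∘L T ∘L S.subtypeL‖ ≤ ‖T‖ := by
  have h1 : ‖S.subtypeL‖ ≤ 1 := Submodule.norm_subtypeL_le _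
  have h2 : ‖ContinuousLinearMap.adjoint S.subtypeL‖ ≤ 1 := by
    rwa [LinearIsometryEquiv.norm_map]
  refine (ContinuousLinearMap.opNorm_comp_le _ _).trans
    ((mul_le_of_le_one_left (norm_nonneg _) h2).trans ?_)
  exact (ContinuousLinearMap.opNorm_comp_le _ _).trans (mul_le_of_le_one_right (norm_nonneg _) h1)

/-- The compression of operators to a closed subspace. -/
def compressL : (H →L[ℝ] H) →L[ℝ] (S →L[ℝ] S) :=
  LinearMap.mkContinuous
    { toFun := fun T => (ContinuousLinearMap.adjoint S.subtypeL) ∘L T ∘L S.subtypeL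
      map_add' := fun T T' => by
        rw [ContinuousLinearMap.add_comp, ContinuousLinearMap.comp_add]
      map_smul' := fun c T => by
        rw [ContinuousLinearMap.smul_comp, ContinuousLinearMap.comp_smul, RingHom.id_apply] }
    1 fun T => (norm_adjoint_subtypeL_comp_le S T).trans (one_mul _).ge

theorem inner_compressL (T : H →L[ℝ] H) (g h : S) :
    inner ℝ (compressL S T g) h = inner ℝ (T g) (h : H) :=
  ContinuousLinearMap.adjoint_inner_left S.subtypeL h (T g)

theorem norm_compressL_le (T : H →L[ℝ] H) : ‖compressL S T‖ ≤ ‖T‖ :=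
  norm_adjoint_subtypeL_comp_le S T

end Compression

/-! ### The energy space of a weight -/

namespace BoundedOpen

variable {d : ℕ} {D : BoundedOpen d}

namespace H10

theorem norm_eq (v : D.H10) : ‖v‖ = ‖grad v‖ := rfl

/-- The embedding of `H¹₀(D)` into `L²(D) × L²(D; ℝᵈ)`. -/
def toPair : D.H10 →ₗ[ℝ] D.PairSpace := D.testPairs.topologicalClosure.subtype

/-- By Poincaré's inequality the gradient norm is equivalent to the norm of the pair `(v, ∇v)`, for
which the space is closed by definition. -/
instance : CompleteSpace D.H10 := by
  obtain ⟨R, hR⟩ := D.isBounded.exists_norm_le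
  have hle : ∀ v : D.H10, ‖toPair v‖ ≤ max (2 * max R 0) 1 * ‖v‖ := by
    intro v
    have h := D.norm_fst_le (R := max R 0) (fun x hx => (hR x hx).trans (le_max_left _ _))
      (le_max_right _ _) v.2
    refine max_le (h.trans ?_) ?_
    · exact mul_le_mul_of_nonneg_right (le_max_left _ _) (norm_nonneg _)
    · exact le_mul_of_one_le_left (norm_nonneg _) (le_max_right _ _)
  have hge : ∀ v : D.H10, ‖v‖ ≤ (1 : NNReal) * ‖toPair v‖ := by
    intro v
    rw [NNReal.coe_one, one_mul]
    exact le_max_right _ _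
  have hind : IsUniformInducing (toPair : D.H10 → D.PairSpace) :=
    (AddMonoidHomClass.antilipschitz_of_bound toPair hge).isUniformInducing
      (AddMonoidHomClass.uniformContinuous_of_bound toPair _ hle)
  rw [completeSpace_iff_isComplete_range hind]
  have : range (toPair : D.H10 → D.PairSpace) = D.testPairs.topologicalClosure :=
    Subtype.range_coe
  rw [this]
  exact D.testPairs.isClosed_topologicalClosure.isComplete

theorem isClosed_range_grad :
    IsClosed (LinearMap.range (grad : D.H10 →ₗ[ℝ] _) :
      Set (Lp (EuclideanSpace ℝ (Fin d)) 2 D.vol)) := by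
  have h : Isometry (grad : D.H10 → _) := AddMonoidHomClass.isometry_of_norm grad fun _ => rfl
  exact h.isClosedEmbedding.isClosed_range

end H10

variable (D) in
/-- Multiplication by bounded functions, on `L²(D; ℝᵈ)`. -/
def mulL : Lp ℝ ⊤ D.vol →L[ℝ] Lp (EuclideanSpace ℝ (Fin d)) 2 D.vol →L[ℝ]
    Lp (EuclideanSpace ℝ (Fin d)) 2 D.vol :=
  (ContinuousLinearMap.lsmul ℝ ℝ : ℝ →L[ℝ] EuclideanSpace ℝ (Fin d) →L[ℝ]
    EuclideanSpace ℝ (Fin d)).holderL D.vol ⊤ 2 2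

theorem coeFn_mulL (m : Lp ℝ ⊤ D.vol) (g : Lp (EuclideanSpace ℝ (Fin d)) 2 D.vol) :
    D.mulL m g =ᵐ[D.vol] fun x => m x • g x :=
  ContinuousLinearMap.coeFn_holder (r := 2) _ m g

theorem norm_mulL_le (m : Lp ℝ ⊤ D.vol) : ‖D.mulL m‖ ≤ ‖m‖ := by
  refine ContinuousLinearMap.opNorm_le_bound _ (norm_nonneg _) fun g => ?_
  refine (ContinuousLinearMap.norm_holder_apply_apply_le (r := 2) _ m g).trans ?_
  refine mul_le_mul_of_nonneg_right (mul_le_of_le_one_left (norm_nonneg _) ?_) (norm_nonneg _)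
  exact ContinuousLinearMap.opNorm_lsmul_le

variable (D) in
/-- With `w = κ^{-1/2}`, the functions `κ^{1/2} ∇v` in `L²(D; ℝᵈ)` with `v ∈ H¹₀(D)`. -/
def energySpace (w : Lp ℝ ⊤ D.vol) : Submodule ℝ (Lp (EuclideanSpace ℝ (Fin d)) 2 D.vol) :=
  (LinearMap.range (H10.grad : D.H10 →ₗ[ℝ] _)).comap (D.mulL w).toLinearMap

instance (w : Lp ℝ ⊤ D.vol) : CompleteSpace (D.energySpace w) :=
  (H10.isClosed_range_grad.preimage (D.mulL w).continuous).completeSpace_coe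

namespace energySpace

variable (w : Lp ℝ ⊤ D.vol)

/-- The map `κ^{1/2} ∇v ↦ v`. -/
def toH10 : D.energySpace w →L[ℝ] D.H10 :=
  LinearMap.mkContinuous
    ((LinearEquiv.ofInjective H10.grad H10.grad_injective).symm.toLinearMap ∘ₗ
      LinearMap.codRestrict _ ((D.mulL w).toLinearMap ∘ₗ (D.energySpace w).subtype) fun g => g.2)
    ‖w‖ fun g => by
      rw [H10.norm_eq]
      have : H10.grad (((LinearEquiv.ofInjective H10.grad H10.grad_injective).symm.toLinearMap ∘ₗ
          LinearMap.codRestrict _ ((D.mulL w).toLinearMap ∘ₗ (D.energySpace w).subtype)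
            fun g => g.2) g) = D.mulL w g :=
        congrArg Subtype.val
          ((LinearEquiv.ofInjective H10.grad H10.grad_injective).apply_symm_apply _)
      rw [this]
      exact (ContinuousLinearMap.le_opNorm _ _).trans
        (mul_le_mul_of_nonneg_right (norm_mulL_le w) (norm_nonneg _))

theorem grad_toH10 (g : D.energySpace w) : H10.grad (toH10 w g) = D.mulL w g :=
  congrArg Subtype.val ((LinearEquiv.ofInjective H10.grad H10.grad_injective).apply_symm_apply _)

theorem norm_toH10_le : ‖toH10 w‖ ≤ ‖w‖ := LinearMap.mkContinuous_norm_le _ (norm_nonneg _) _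

/-- The compression to the energy space of multiplication by a bounded function. -/
def compression : Lp ℝ ⊤ D.vol →L[ℝ] (D.energySpace w →L[ℝ] D.energySpace w) :=
  (compressL (D.energySpace w)) ∘L D.mulL

theorem inner_compression (m : Lp ℝ ⊤ D.vol) (g h : D.energySpace w) :
    inner ℝ (compression w m g) h =
      inner ℝ (D.mulL m g) (h : Lp (EuclideanSpace ℝ (Fin d)) 2 D.vol) :=
  inner_compressL (D.energySpace w) (D.mulL m) g h

theorem norm_compression_le (m : Lp ℝ ⊤ D.vol) : ‖compression w m‖ ≤ ‖m‖ :=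
  (norm_compressL_le (D.energySpace w) (D.mulL m)).trans (norm_mulL_le m)

theorem compression_eq_one {m : Lp ℝ ⊤ D.vol} (hm : ∀ᵐ x ∂D.vol, m x = 1) :
    compression w m = 1 := by
  ext1 g
  refine ext_inner_right ℝ fun h => ?_
  have : D.mulL m g = (g : Lp (EuclideanSpace ℝ (Fin d)) 2 D.vol) := by
    refine Lp.ext ?_
    filter_upwards [coeFn_mulL m (g : Lp (EuclideanSpace ℝ (Fin d)) 2 D.vol), hm] with x h1 h2
    rw [h1, h2, one_smul]
  rw [inner_compression, this]
  rfl

/-- Lax–Milgram: the quadratic form of the compression is at least `k ‖g‖²`. -/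
theorem isUnit_compression {m : Lp ℝ ⊤ D.vol} {k : ℝ} (hk : 0 < k) (hm : ∀ᵐ x ∂D.vol, k ≤ m x) :
    IsUnit (compression w m) := by
  refine ContinuousLinearMap.isUnit_of_forall_le_norm_inner_map _ (c := ⟨k, hk.le⟩) hk fun g => ?_
  refine le_trans ?_ (Real.le_norm_self _)
  rw [inner_compression, L2.inner_def]
  have h1 : ‖g‖ ^ 2 * k = ∫ x, k * inner ℝ ((g : Lp (EuclideanSpace ℝ (Fin d)) 2 D.vol) x)
      ((g : Lp (EuclideanSpace ℝ (Fin d)) 2 D.vol) x) ∂D.vol := by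
    rw [integral_const_mul, ← L2.inner_def, real_inner_self_eq_norm_sq, mul_comm]
    rfl
  refine h1.le.trans (integral_mono_ae ((L2.integrable_inner _ _).const_mul _)
    (L2.integrable_inner _ _) ?_)
  filter_upwards [coeFn_mulL m (g : Lp (EuclideanSpace ℝ (Fin d)) 2 D.vol), hm] with x h1 h2
  rw [h1, real_inner_smul_left]
  exact mul_le_mul_of_nonneg_right h2 real_inner_self_nonneg

/-- The representative in the energy space of `f ∈ H⁻¹(D)`. -/
def riesz (f : D.Hneg1) : D.energySpace w :=
  (InnerProductSpace.toDual ℝ (D.energySpace w)).symm (f ∘L toH10 w)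

theorem inner_riesz (f : D.Hneg1) (h : D.energySpace w) :
    inner ℝ (riesz w f) h = f (toH10 w h) := by
  simp [riesz]

theorem norm_riesz_le (f : D.Hneg1) : ‖riesz w f‖ ≤ ‖f‖ * ‖w‖ := by
  rw [riesz, LinearIsometryEquiv.norm_map]
  exact (ContinuousLinearMap.opNorm_comp_le _ _).trans
    (mul_le_mul_of_nonneg_left (norm_toH10_le w) (norm_nonneg _))

/-- The two weights cancel against the base coefficient: `κ (w g)·(w h) = (κ/κ₀) g·h`, since `w² =
1/κ₀`. -/
theorem ae_inner_eq
    {w : Lp ℝ ⊤ D.vol} {κ κ₀ : EuclideanSpace ℝ (Fin d) → ℝ} (hκ₀ : ∀ᵐ x ∂D.vol, 0 < κ₀ x)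
    (hw : w =ᵐ[D.vol] fun x => (√(κ₀ x))⁻¹)
    {m : Lp ℝ ⊤ D.vol} (hm : m =ᵐ[D.vol] fun x => κ x / κ₀ x)
    (g h : D.energySpace w) :
    (fun x => inner ℝ (D.mulL m g x) ((h : Lp (EuclideanSpace ℝ (Fin d)) 2 D.vol) x)) =ᵐ[D.vol]
      fun x => κ x * inner ℝ (H10.grad (toH10 w g) x) (H10.grad (toH10 w h) x) := by
  filter_upwards [hκ₀, hw, hm, coeFn_mulL m (g : Lp (EuclideanSpace ℝ (Fin d)) 2 D.vol),
    coeFn_mulL w (g : Lp (EuclideanSpace ℝ (Fin d)) 2 D.vol),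
    coeFn_mulL w (h : Lp (EuclideanSpace ℝ (Fin d)) 2 D.vol)] with x h0 h1 h2 h3 h4 h5
  rw [grad_toH10, grad_toH10, h3, h4, h5, h1, h2, real_inner_smul_left, real_inner_smul_left,
    real_inner_smul_right]
  have : √(κ₀ x) * √(κ₀ x) = κ₀ x := Real.mul_self_sqrt h0.le
  rw [div_eq_mul_inv]
  nth_rewrite 1 [← this]
  rw [mul_inv]
  ring

theorem integrable_of_toH10
    {w : Lp ℝ ⊤ D.vol} {κ κ₀ : EuclideanSpace ℝ (Fin d) → ℝ} (hκ₀ : ∀ᵐ x ∂D.vol, 0 < κ₀ x)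
    (hw : w =ᵐ[D.vol] fun x => (√(κ₀ x))⁻¹)
    {m : Lp ℝ ⊤ D.vol} (hm : m =ᵐ[D.vol] fun x => κ x / κ₀ x)
    (g h : D.energySpace w) :
    Integrable (fun x => κ x * inner ℝ (H10.grad (toH10 w g) x) (H10.grad (toH10 w h) x)) D.vol :=
  (L2.integrable_inner (𝕜 := ℝ) (D.mulL m g)
    (h : Lp (EuclideanSpace ℝ (Fin d)) 2 D.vol)).congr (ae_inner_eq hκ₀ hw hm g h)

theorem inner_compression_eq
    {w : Lp ℝ ⊤ D.vol} {κ κ₀ : EuclideanSpace ℝ (Fin d) → ℝ} (hκ₀ : ∀ᵐ x ∂D.vol, 0 < κ₀ x)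
    (hw : w =ᵐ[D.vol] fun x => (√(κ₀ x))⁻¹)
    {m : Lp ℝ ⊤ D.vol} (hm : m =ᵐ[D.vol] fun x => κ x / κ₀ x)
    (g h : D.energySpace w) :
    inner ℝ (compression w m g) h =
      ∫ x, κ x * inner ℝ (H10.grad (toH10 w g) x) (H10.grad (toH10 w h) x) ∂D.vol := by
  rw [inner_compression, L2.inner_def]
  exact integral_congr_ae (ae_inner_eq hκ₀ hw hm g h)

/-- The preimage is `√κ₀ ∇v`; finite energy is exactly what places it in `L²`. -/
theorem exists_toH10_eq
    {w : Lp ℝ ⊤ D.vol} {κ₀ : EuclideanSpace ℝ (Fin d) → ℝ} (hκ₀ : ∀ᵐ x ∂D.vol, 0 < κ₀ x)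
    (hw : w =ᵐ[D.vol] fun x => (√(κ₀ x))⁻¹)
    (hmeas : AEStronglyMeasurable κ₀ D.vol) {v : D.H10}
    (hv : Integrable (fun x => κ₀ x * ‖H10.grad v x‖ ^ 2) D.vol) :
    ∃ g : D.energySpace w, toH10 w g = v := by
  have hmem : MemLp (fun x => √(κ₀ x) • H10.grad v x) 2 D.vol := by
    refine (memLp_two_iff_integrable_sq_norm ((Real.continuous_sqrt.comp_aestronglyMeasurable
      hmeas).smul (Lp.aestronglyMeasurable _))).2 (hv.congr ?_)
    filter_upwards [hκ₀] with x h0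
    rw [Pi.smul_apply', norm_smul, mul_pow, Real.norm_eq_abs, sq_abs, Real.sq_sqrt h0.le]
  have hg : D.mulL w hmem.toLp = H10.grad v := by
    refine Lp.ext ?_
    filter_upwards [hκ₀, hw, coeFn_mulL w hmem.toLp, hmem.coeFn_toLp] with x h0 h1 h2 h3
    rw [h2, h3, h1, smul_smul, inv_mul_cancel₀ (Real.sqrt_pos.2 h0).ne', one_smul]
  refine ⟨⟨hmem.toLp, v, hg.symm⟩, H10.grad_injective ?_⟩
  rw [grad_toH10]
  exact hg

/-- A weak solution comes from a solution of an operator equation in the energy space. -/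
theorem exists_compression_eq_riesz
    {w : Lp ℝ ⊤ D.vol} {κ κ₀ : EuclideanSpace ℝ (Fin d) → ℝ} (hκ₀ : ∀ᵐ x ∂D.vol, 0 < κ₀ x)
    (hw : w =ᵐ[D.vol] fun x => (√(κ₀ x))⁻¹)
    (hmeas : AEStronglyMeasurable κ₀ D.vol) {K : ℝ}
    (hK : ∀ᵐ x ∂D.vol, κ₀ x ≤ K * κ x) {m : Lp ℝ ⊤ D.vol}
    (hm : m =ᵐ[D.vol] fun x => κ x / κ₀ x) {f : D.Hneg1} {v : D.H10}
    (hv : D.IsWeakSolution κ f v) :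
    ∃ g : D.energySpace w, toH10 w g = v ∧ compression w m g = riesz w f := by
  have hint : Integrable (fun x => κ₀ x * ‖H10.grad v x‖ ^ 2) D.vol := by
    -- Testing the weak solution with itself gives finite energy for `κ`, and `κ₀ ≤ K κ` transfers
    -- it to `κ₀`.
    refine ((hv v).1.const_mul K).mono' (hmeas.mul ((Lp.aestronglyMeasurable _).norm.pow 2)) ?_
    filter_upwards [hκ₀, hK] with x h0 h1
    rw [real_inner_self_eq_norm_sq, Real.norm_of_nonneg (by positivity), ← mul_assoc]
    gcongr
  obtain ⟨g, rfl⟩ := exists_toH10_eq hκ₀ hw hmeas hint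
  refine ⟨g, rfl, ext_inner_right ℝ fun h => ?_⟩
  rw [inner_compression_eq hκ₀ hw hm, inner_riesz, (hv _).2]

/-- With the weight equal to the coefficient the operator is the identity, so the Riesz
representative solves the equation. Boundedness of `κ₀` gives every test function finite energy, so
the energy space covers all of `H¹₀(D)`. -/
theorem isWeakSolution_riesz
    {w : Lp ℝ ⊤ D.vol} {κ₀ : EuclideanSpace ℝ (Fin d) → ℝ} (hκ₀ : ∀ᵐ x ∂D.vol, 0 < κ₀ x)
    (hw : w =ᵐ[D.vol] fun x => (√(κ₀ x))⁻¹)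
    (hmem : MemLp κ₀ ⊤ D.vol) (f : D.Hneg1) :
    D.IsWeakSolution κ₀ f (toH10 w (riesz w f)) := by
  have hmem1 : MemLp (fun x => κ₀ x / κ₀ x) ⊤ D.vol := by
    refine (memLp_congr_ae ?_).2 (memLp_top_const (1 : ℝ))
    filter_upwards [hκ₀] with x h0
    exact div_self h0.ne'
  have hone : ∀ᵐ x ∂D.vol, (hmem1.toLp _) x = 1 := by
    filter_upwards [hmem1.coeFn_toLp, hκ₀] with x h1 h0
    rw [h1, div_self h0.ne']
  intro v
  have hint : Integrable (fun x => κ₀ x * ‖H10.grad v x‖ ^ 2) D.vol := by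
    have h2 := (memLp_two_iff_integrable_sq_norm (Lp.aestronglyMeasurable (H10.grad v))).1
      (Lp.memLp _)
    exact (memLp_one_iff_integrable.1
      ((memLp_one_iff_integrable.2 h2).smul (p := ⊤) (r := 1) hmem) :)
  obtain ⟨h, rfl⟩ := exists_toH10_eq hκ₀ hw hmem.1 hint
  refine ⟨integrable_of_toH10 hκ₀ hw hmem1.coeFn_toLp _ _, ?_⟩
  rw [← inner_compression_eq hκ₀ hw hmem1.coeFn_toLp, compression_eq_one w hone, ← inner_riesz]
  rfl

end energySpace

/-- Test both equations with `v₁ - v₂` and subtract; only the lower bound on `κ` is needed, since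
the integrals exist by the definition of a weak solution. -/
theorem IsWeakSolution.unique {κ : EuclideanSpace ℝ (Fin d) → ℝ} {m : ℝ} (hm : 0 < m)
    (hκ : ∀ᵐ x ∂D.vol, m ≤ κ x) {f : D.Hneg1} {v₁ v₂ : D.H10} (h₁ : D.IsWeakSolution κ f v₁)
    (h₂ : D.IsWeakSolution κ f v₂) : v₁ = v₂ := by
  obtain ⟨i₁, e₁⟩ := h₁ (v₁ - v₂)
  obtain ⟨i₂, e₂⟩ := h₂ (v₁ - v₂)
  have heq : (fun x => κ x * inner ℝ (H10.grad (v₁ - v₂) x) (H10.grad (v₁ - v₂) x)) =ᵐ[D.vol]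
      fun x => κ x * inner ℝ (H10.grad v₁ x) (H10.grad (v₁ - v₂) x) -
        κ x * inner ℝ (H10.grad v₂ x) (H10.grad (v₁ - v₂) x) := by
    have : H10.grad (v₁ - v₂) = H10.grad v₁ - H10.grad v₂ := map_sub _ _ _
    filter_upwards [Lp.coeFn_sub (H10.grad v₁) (H10.grad v₂)] with x hx
    rw [← mul_sub, ← inner_sub_left, this, hx, Pi.sub_apply]
  have h0 : ∫ x, κ x * inner ℝ (H10.grad (v₁ - v₂) x) (H10.grad (v₁ - v₂) x) ∂D.vol = 0 := by
    rw [integral_congr_ae heq, integral_sub i₁ i₂, e₁, e₂, sub_self]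
  have hle : m * ‖v₁ - v₂‖ ^ 2 ≤ 0 := by
    rw [← h0, H10.norm_eq, ← real_inner_self_eq_norm_sq, L2.inner_def, ← integral_const_mul]
    refine integral_mono_ae ((L2.integrable_inner _ _).const_mul _) ((i₁.sub i₂).congr heq.symm) ?_
    filter_upwards [hκ] with x hx
    exact mul_le_mul_of_nonneg_right hx real_inner_self_nonneg
  have h1 : ‖v₁ - v₂‖ ^ 2 ≤ 0 := nonpos_of_mul_nonpos_right hle hm
  have h2 : ‖v₁ - v₂‖ = 0 := pow_eq_zero_iff (two_ne_zero) |>.1 (le_antisymm h1 (sq_nonneg _))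
  exact sub_eq_zero.1 (norm_eq_zero.1 h2)

end BoundedOpen


/-! ### Gevrey regularity of the solution -/

open BoundedOpen BoundedOpen.energySpace

section OperatorEquation

theorem hasDerivAt_operator_comp {H V : Type*} [NormedAddCommGroup H] [NormedSpace ℝ H]
    [NormedAddCommGroup V] [NormedSpace ℝ V] (L : V →L[ℝ] (H →L[ℝ] H)) {F : ℝ → V} {F' : V} {t : ℝ}
    (h : HasDerivAt F F' t) : HasDerivAt (fun t => L (F t)) (L F') t :=
  L.hasFDerivAt.comp_hasDerivAt t h

variable {H V : Type*} [NormedAddCommGroup H] [NormedSpace ℝ H] [CompleteSpace H]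
  [NormedAddCommGroup V] [NormedSpace ℝ V]

/-- Gevrey regularity of the solution of a parametric operator equation. -/
theorem mixedPartial_of_operator_equation {X : Set (ℕ → ℝ)}
    (hX : ∀ y ∈ X, ∀ j t, Function.update y j t ∈ X) {T : (ℕ →₀ ℕ) → (ℕ → ℝ) → (H →L[ℝ] H)}
    (hT : ∀ ν, ∀ y ∈ X, ∀ j, HasDerivAt (fun t : ℝ => T ν (Function.update y j t))
      (T (ν + Finsupp.single j 1) y) (y j))
    (hunit : ∀ y ∈ X, IsUnit (T 0 y)) {J : H →L[ℝ] V} {F : H} {u : (ℕ → ℝ) → V}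
    (hsol : ∀ y ∈ X, ∃ g, J g = u y ∧ T 0 y g = F) {y₀ : ℕ → ℝ} (hy₀ : y₀ ∈ X)
    {σ C : ℝ} {b : ℕ → ℝ} (hσ : 1 ≤ σ) (hC : 0 ≤ C) (hb : ∀ j, 0 ≤ b j) (hone : T 0 y₀ = 1)
    (hbound : ∀ ν, ‖T ν y₀‖ ≤ gevreyBound σ C b ν) (ν : ℕ →₀ ℕ) :
    (∀ j, HasDerivAt (fun t : ℝ => mixedPartial ν u (Function.update y₀ j t))
      (mixedPartial (ν + Finsupp.single j 1) u y₀) (y₀ j)) ∧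
    ‖mixedPartial ν u y₀‖ ≤ ‖J‖ * ‖F‖ * gevreyFactor C ν.degree *
      (ν.degree.factorial : ℝ) ^ σ * multiPow b ν := by
  let B : (ℕ → ℝ) → (ℕ →₀ ℕ) → (H →L[ℝ] H) := fun y ν => (multiFactorial ν)⁻¹ • T ν y
  have hB0 : ∀ y, B y 0 = T 0 y := fun y => by
    simp only [B, multiFactorial_zero, inv_one, one_smul]
  have hBu : ∀ y ∈ X, IsUnit (B y 0) := fun y hy => (hB0 y).symm ▸ hunit y hy
  -- Placing `y ∈ X` inside the existential lets `choose` produce a `Q` defined for every `y`; its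
  -- values off `X` are irrelevant.
  have hQ : ∀ y, ∃ Q : (ℕ →₀ ℕ) → (H →L[ℝ] H), y ∈ X → ∀ ν,
      ∑ p ∈ HasAntidiagonal.antidiagonal ν, B y p.1 * Q p.2 = if ν = 0 then 1 else 0 := by
    intro y
    by_cases hy : y ∈ X
    · obtain ⟨Q, hQ⟩ := exists_inverse_coeff (hBu y hy)
      exact ⟨Q, fun _ => hQ⟩
    · exact ⟨0, fun h => absurd h hy⟩
  choose Q hQ using hQ
  have h0 : ∀ y ∈ X, u y = multiFactorial 0 • J (Q y 0 F) := by
    intro y hy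
    obtain ⟨g, hg, hgF⟩ := hsol y hy
    have h1 : B y 0 * Q y 0 = 1 := by simpa using hQ y hy 0
    -- The series inverse is only a right inverse; because `B y 0` is a unit, its constant
    -- coefficient is two-sided, as needed to recover `g` from `F`.
    have h2 : Q y 0 * B y 0 = 1 := by
      obtain ⟨x, hx⟩ := hBu y hy
      rw [← hx] at h1 ⊢
      rw [← Units.inv_eq_of_mul_eq_one_right h1, Units.inv_mul]
    rw [multiFactorial_zero, one_smul, ← hgF, ← hB0, ← mul_apply_eq_comp, h2,
      one_apply_eq_self, hg]
  have hW : ∀ ν, ∀ y ∈ X, ∀ j, HasDerivAt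
      (fun t : ℝ => multiFactorial ν • J (Q (Function.update y j t) ν F))
      (multiFactorial (ν + Finsupp.single j 1) • J (Q y (ν + Finsupp.single j 1) F)) (y j) := by
    intro ν y hy j
    have hB : ∀ ν, HasDerivAt (fun t => B (Function.update y j t) ν)
        (((ν j : ℝ) + 1) • B (Function.update y j (y j)) (ν + Finsupp.single j 1)) (y j) := by
      intro ν
      refine ((hT ν y hy j).const_smul (multiFactorial ν)⁻¹).congr_deriv ?_
      rw [Function.update_eq_self]
      simp only [B]
      rw [smul_smul, multiFactorial_add_single, mul_inv, mul_inv_cancel_left₀ (by positivity)]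
    have h := hasDerivAt_inverse_coeff (B := fun t => B (Function.update y j t))
      (Q := fun t => Q (Function.update y j t)) (j := j) (t₀ := y j) hB
      (fun t => hBu _ (hX y hy j t)) (fun t => hQ _ (hX y hy j t)) ν
    have h2 := (J.hasFDerivAt.comp_hasDerivAt (y j)
      (h.clm_apply (hasDerivAt_const (y j) F))).const_smul (multiFactorial ν)
    refine h2.congr_deriv ?_
    rw [multiFactorial_add_single, Function.update_eq_self]
    simp only [map_zero, add_zero, smul_apply, map_smul]
    rw [smul_smul, mul_comm]
  have key := mixedPartial_eq_of_hasDerivAt hX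
    (W := fun ν y => multiFactorial ν • J (Q y ν F)) h0 hW
  refine ⟨fun j => ?_, ?_⟩
  · rw [key _ y₀ hy₀, funext fun t => key ν _ (hX y₀ hy₀ j t)]
    exact hW ν y₀ hy₀ j
  have hB : ∀ ν, ‖B y₀ ν‖ ≤
      C * (ν.degree.factorial : ℝ) ^ σ / multiFactorial ν * multiPow b ν := by
    intro ν
    have hν := multiFactorial_pos ν
    calc ‖B y₀ ν‖ = (multiFactorial ν)⁻¹ * ‖T ν y₀‖ := by
          simp only [B]
          rw [norm_smul, Real.norm_of_nonneg (inv_nonneg.2 hν.le)]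
      _ ≤ (multiFactorial ν)⁻¹ * gevreyBound σ C b ν := by
          gcongr
          exact hbound ν
      _ = _ := by rw [gevreyBound]; ring
  have hn := norm_inverse_coeff_le hσ hC hb ContinuousLinearMap.norm_id_le
    ((hB0 y₀).trans hone) hB (hQ y₀ hy₀) ν
  have hν := multiFactorial_pos ν
  rw [key ν y₀ hy₀, norm_smul, Real.norm_of_nonneg hν.le]
  calc multiFactorial ν * ‖J (Q y₀ ν F)‖
      ≤ multiFactorial ν * (‖J‖ * (‖Q y₀ ν‖ * ‖F‖)) := by
        gcongr
        exact (J.le_opNorm _).trans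
          (mul_le_mul_of_nonneg_left ((Q y₀ ν).le_opNorm _) (norm_nonneg _))
    _ = multiFactorial ν * ((‖J‖ * ‖F‖) * ‖Q y₀ ν‖) := by ring
    _ ≤ multiFactorial ν * (‖J‖ * ‖F‖ * (gevreyFactor C ν.degree *
          (ν.degree.factorial : ℝ) ^ σ / multiFactorial ν * multiPow b ν)) := by
        gcongr
    _ = _ := by field_simp

end OperatorEquation

section Regularity

variable {d : ℕ} {D : BoundedOpen d} {U : Set (ℕ → ℝ)}
  {a : EuclideanSpace ℝ (Fin d) → (ℕ → ℝ) → ℝ} {σ C : ℝ} {b : ℕ → ℝ}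

/-- A function bounded below has an inverse square root in `L^∞(D)`. -/
theorem exists_Lp_inv_sqrt {κ : EuclideanSpace ℝ (Fin d) → ℝ}
    (hmeas : AEStronglyMeasurable κ D.vol) {m : ℝ} (hm : 0 < m) (hκ : ∀ᵐ x ∂D.vol, m ≤ κ x) :
    ∃ w : Lp ℝ ⊤ D.vol, (w =ᵐ[D.vol] fun x => (√(κ x))⁻¹) ∧ ‖w‖ ≤ (√m)⁻¹ := by
  have hb : ∀ᵐ x ∂D.vol, ‖(√(κ x))⁻¹‖ ≤ (√m)⁻¹ := by
    filter_upwards [hκ] with x hx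
    rw [Real.norm_of_nonneg (by positivity)]
    exact inv_anti₀ (Real.sqrt_pos.2 hm) (Real.sqrt_le_sqrt hx)
  have hmem : MemLp (fun x => (√(κ x))⁻¹) ⊤ D.vol :=
    memLp_top_of_bound
      (hmeas.aemeasurable.sqrt.inv.aestronglyMeasurable) _ hb
  refine ⟨hmem.toLp _, hmem.coeFn_toLp, norm_Lp_top_le (by positivity) ?_⟩
  filter_upwards [hb, hmem.coeFn_toLp] with x h1 h2
  rwa [h2]

/-- The base point is the very point at which the derivative is estimated. Hence the operator there
is the identity, and no ratio of upper to lower bounds of `a` enters. -/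
theorem mixedPartial_solution
    (hG : IsGevreyCoefficient D U a σ C b)
    (hpos : ∀ x ∈ D.carrier, ∀ y ∈ U, 0 < a x y)
    (hU : ∀ y ∈ U, ∀ j t, Function.update y j t ∈ U)
    {f : D.Hneg1} {u : (ℕ → ℝ) → D.H10}
    (hu : ∀ y ∈ U, D.IsWeakSolution (fun x => a x y) f (u y)) {y₀ : ℕ → ℝ} (hy₀ : y₀ ∈ U) {m : ℝ}
    (hm : 0 < m) (hlow : ∀ x ∈ D.carrier, m ≤ a x y₀) (ν : ℕ →₀ ℕ) :
    (∀ j, HasDerivAt (fun t : ℝ => mixedPartial ν u (Function.update y₀ j t))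
      (mixedPartial (ν + Finsupp.single j 1) u y₀) (y₀ j)) ∧
    ‖mixedPartial ν u y₀‖ ≤ ‖f‖ / m * gevreyFactor C ν.degree *
      (ν.degree.factorial : ℝ) ^ σ * multiPow b ν := by
  have hmem : ∀ᵐ x ∂D.vol, x ∈ D.carrier := ae_restrict_mem D.isOpen.measurableSet
  have hκ₀ : ∀ᵐ x ∂D.vol, 0 < a x y₀ := hmem.mono fun x hx => hpos x hx y₀ hy₀
  obtain ⟨w, hw, hwm⟩ := exists_Lp_inv_sqrt (hG.measurable y₀ hy₀) hm (hmem.mono hlow)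
  have hy₀X : y₀ ∈ comparableSet D U a y₀ := ⟨hy₀, 1, one_pos, by simp⟩
  have hone : compression w (relativePartial D a y₀ 0 y₀) = 1 := by
    refine compression_eq_one w ?_
    filter_upwards [hG.coeFn_relativePartial hpos hU hy₀ hy₀X 0, hκ₀] with x h1 h0
    rw [h1, mixedPartial_zero, div_self h0.ne']
  have hunit : ∀ y ∈ comparableSet D U a y₀,
      IsUnit (compression w (relativePartial D a y₀ 0 y)) := by
    intro y hy
    obtain ⟨K, hK, hcomp⟩ := hy.2
    refine isUnit_compression w (inv_pos.2 hK) ?_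
    filter_upwards [hcomp, hG.coeFn_relativePartial hpos hU hy₀ hy 0, hκ₀] with x ⟨_, h1⟩ h2 h0
    rw [h2, mixedPartial_zero, le_div_iff₀ h0, inv_mul_le_iff₀ hK]
    exact h1
  have hsol : ∀ y ∈ comparableSet D U a y₀, ∃ g : D.energySpace w, toH10 w g = u y ∧
      compression w (relativePartial D a y₀ 0 y) g = riesz w f := by
    intro y hy
    obtain ⟨K, hK, hcomp⟩ := hy.2
    exact exists_compression_eq_riesz hκ₀ hw (hG.measurable y₀ hy₀)
      (hcomp.mono fun x hx => hx.2)
      (by simpa only [mixedPartial_zero] using hG.coeFn_relativePartial hpos hU hy₀ hy 0)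
      (hu y hy.1)
  -- Each factor contributes one `‖w‖ ≤ m^{-1/2}`, together `1/m`.
  have hFm : ‖toH10 w‖ * ‖riesz w f‖ ≤ ‖f‖ / m := by
    have h1 : ‖w‖ * ‖w‖ ≤ m⁻¹ := by
      refine (mul_le_mul hwm hwm (norm_nonneg _) (by positivity)).trans (le_of_eq ?_)
      rw [← mul_inv, Real.mul_self_sqrt hm.le]
    refine (mul_le_mul (norm_toH10_le w) (norm_riesz_le w f) (norm_nonneg _)
      (norm_nonneg _)).trans ?_
    rw [mul_left_comm, div_eq_mul_inv]
    exact mul_le_mul_of_nonneg_left h1 (norm_nonneg f)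
  have key := mixedPartial_of_operator_equation
    (fun y hy j t => hG.update_mem_comparableSet hpos hU hy j t)
    (T := fun ν y => compression w (relativePartial D a y₀ ν y))
    (fun ν y hy j =>
      hasDerivAt_operator_comp (compression w) (hG.hasDerivAt_relativePartial hpos hU hy₀ hy ν j))
    hunit hsol hy₀X hG.one_le_sigma hG.C_pos.le hG.b_nonneg hone
    (fun ν => (norm_compression_le w _).trans (hG.norm_relativePartial_le hpos hU hy₀ hy₀X ν)) ν
  refine ⟨key.1, key.2.trans ?_⟩
  have h1 := gevreyFactor_nonneg hG.C_pos.le ν.degree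
  have h2 := multiPow_nonneg hG.b_nonneg ν
  gcongr

end Regularity

end

theorem mainTheorem4 {d : ℕ} (D : BoundedOpen d) (β τ σ c C : ℝ) (α b : ℕ → ℝ)
    (a : EuclideanSpace ℝ (Fin d) → (ℕ → ℝ) → ℝ) (f : D.Hneg1)
    (hGevrey : IsGevreyCoefficient D (paramSet α τ) a σ C b)
    (hLower : IsLowerBounded D a c α τ β) :
    (∀ y ∈ paramSet α τ, MemLp (fun x => a x y) ⊤ D.vol →
      ∃! w : D.H10, D.IsWeakSolution (fun x => a x y) f w) ∧
    (∀ u : (ℕ → ℝ) → D.H10,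
      (∀ y ∈ paramSet α τ, D.IsWeakSolution (fun x => a x y) f (u y)) →
      HasAllMixedPartials (paramSet α τ) u ∧
      ∀ ν : ℕ →₀ ℕ, ν ≠ 0 → ∀ y ∈ paramSet α τ,
        ‖mixedPartial ν u y‖ ≤
          ‖f‖ / aMin c α τ y * (C * (C + 1) ^ (ν.degree - 1)) *
            (ν.degree.factorial : ℝ) ^ σ * multiPow b ν) := by
  have hmin : ∀ y, 0 < aMin c α τ y := fun y => mul_pos hLower.c_pos (Real.exp_pos _)
  have hpos : ∀ x ∈ D.carrier, ∀ y ∈ paramSet α τ, 0 < a x y := fun x hx y hy =>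
    (hmin y).trans_le (hLower.lower x hx y hy)
  have hU : ∀ y ∈ paramSet α τ, ∀ j t, Function.update y j t ∈ paramSet α τ := fun _ hy =>
    update_mem_paramSet hy
  constructor
  · intro y hy hmem
    have hae : ∀ᵐ x ∂D.vol, aMin c α τ y ≤ a x y :=
      (ae_restrict_mem D.isOpen.measurableSet).mono fun x hx => hLower.lower x hx y hy
    obtain ⟨w, hw, -⟩ := exists_Lp_inv_sqrt hmem.1 (hmin y) hae
    have hsol := BoundedOpen.energySpace.isWeakSolution_riesz
      (hae.mono fun x hx => (hmin y).trans_le hx) hw hmem f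
    exact ⟨_, hsol, fun v hv => hv.unique (hmin y) hae hsol⟩
  · intro u hu
    -- Every `y` serves as its own base point, with lower bound `m = a_min(y)`.
    refine ⟨fun ν y hy j => (mixedPartial_solution hGevrey hpos hU hu hy (hmin y)
      (fun x hx => hLower.lower x hx y hy) ν).1 j, fun ν hν y hy => ?_⟩
    have h := (mixedPartial_solution hGevrey hpos hU hu hy (hmin y)
      (fun x hx => hLower.lower x hx y hy) ν).2
    rwa [gevreyFactor, if_neg (mt (Finsupp.degree_eq_zero_iff ν).1 hν)] at h
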